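/- Theorem 6.1 (Gaussian cubature of $m$-degree for $w_{\frac12,\frac12}$). Write points of the plane $t_1+t_2+t_3=0$ as $\mathbf t=(t_1,t_2,t_3)$. Let $A_2=\{1,\sigma_1,\sigma_2,\sigma_3,\sigma_1\sigma_2,\sigma_2\sigma_1\}$, acting on the right by $\mathbf t\sigma_1=-(t_1,t_3,t_2)$, $\mathbf t\sigma_2=-(t_2,t_1,t_3)$, $\mathbf t\sigma_3=-(t_3,t_2,t_1)$, with $(-1)^{|\sigma|}=-1$ for $\sigma=\sigma_1,\sigma_2,\sigma_3$ and $(-1)^{|\sigma|}=1$ for the other three elements. For $\mathbf k\in\mathbb Z^3$ with $k_1+k_2+k_3=0$ put $\phi_{\mathbf k}(\mathbf t)=e^{\frac{2\pi i}{3}\mathbf k\cdot\mathbf t}$ and $$\mathsf{CC}_{\mathbf k}(\mathbf t)=\frac1{12}\sum_{\sigma\in A_2}\big(\phi_{\mathbf k}(\mathbf t\sigma)+\phi_{\mathbf k}(-\mathbf t\sigma)\big),\qquad \mathsf{SS}_{\mathbf k}(\mathbf t)=-\frac1{12}\sum_{\sigma\in A_2}(-1)^{|\sigma|}\big(\phi_{\mathbf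 k}(\mathbf t\sigma)+\phi_{\mathbf k}(-\mathbf t\sigma)\big).$$ Let $x(\mathbf t)=\mathsf{CC}_{1,0,-1}(\mathbf t)$ and $y(\mathbf t)=\mathsf{CC}_{1,1,-2}(\mathbf t)$ (both are real valued), let $$\triangle^*=\{(x,y)\in\mathbb R^2:\ 1+2y-3x^2\ge 0,\ \ 24x^3-y^2-12xy-6x-4y-1\ge 0\},$$ $$w_{\frac12,\frac12}(x,y)=\frac{4\pi^2}{3^{3/2}}\,(1+2y-3x^2)^{1/2}\,(24x^3-y^2-12xy-6x-4y-1)^{1/2},\qquad c_{\frac12,\frac12}=\Big(\iint_{\triangle^*}w_{\frac12,\frac12}(x,y)\,dx\,dy\Big)^{-1},$$ and for $m\ge1$ let $$\Upsilon_m^\circ=\{\mathbf j\in\mathbb Z^3:\ j_1+j_2+j_3=0,\ j_1\equiv j_2\equiv j_3\ (\mathrm{mod}\ 3),\ 0<j_2<j_1<-j_3<m\}.$$ Let $\Pi_m^*=\mathrm{span}\{x^{k_1}y^{k_2}: k_1,k_2\ge0,\ 2k_1+3k_2\le m\}$, with real or complex coefficients. Then for every $n\ge1$ and every $f\in\Pi^*_{2n-1}$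 the function $f\,w_{\frac12,\frac12}$ is integrable on $\triangle^*$ and $$\frac{c_{\frac12,\frac12}}{12}\iint_{\triangle^*}f(x,y)\,w_{\frac12,\frac12}(x,y)\,dx\,dy=\frac{12}{(n+5)^2}\sum_{\mathbf j\in\Upsilon^\circ_{n+5}}\big|\mathsf{SS}_{2,1,-3}\big(\tfrac{\mathbf j}{n+5}\big)\big|^2 f\big(x(\tfrac{\mathbf j}{n+5}),y(\tfrac{\mathbf j}{n+5})\big).$$ Moreover the number of nodes equals $\dim\Pi^*_{n-1}$, so that the rule is of Gauss type in the sense of the $m$-degree: both the index set $\Upsilon^\circ_{n+5}$ and the set of points $\big\{\big(x(\tfrac{\mathbf j}{n+5}),y(\tfrac{\mathbf j}{n+5})\big):\mathbf j\in\Upsilon^\circ_{n+5}\big\}$ have exactly $\dim\Pi^*_{n-1}$ elements. -/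

import Mathlib

open MeasureTheory MvPolynomial

noncomputable section

namespace G2Cubature

/-! ### Homogeneous coordinates and the reflections generating the group

Points `t = (t₁, t₂, t₃)` with `t₁ + t₂ + t₃ = 0` are written as functions on `Fin 3`. -/

/-- `t σ₁ = -(t₁, t₃, t₂)`. -/
def sigma1 (t : Fin 3 → ℝ) : Fin 3 → ℝ := ![-t 0, -t 2, -t 1]

/-- `t σ₂ = -(t₂, t₁, t₃)`. -/
def sigma2 (t : Fin 3 → ℝ) : Fin 3 → ℝ := ![-t 1, -t 0, -t 2]

/-- `t σ₃ = -(t₃, t₂, t₁)`. -/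
def sigma3 (t : Fin 3 → ℝ) : Fin 3 → ℝ := ![-t 2, -t 1, -t 0]

/-- The operators `𝒫^±` of the group `A₂`, with `e = 1` for `𝒫^+` and `e = -1` for `𝒫^-`. -/
def projA2 (e : ℂ) (f : (Fin 3 → ℝ) → ℂ) (t : Fin 3 → ℝ) : ℂ :=
  (1 / 6) * (f t + f (sigma2 (sigma1 t)) + f (sigma1 (sigma2 t))
    + e * f (sigma1 t) + e * f (sigma2 t) + e * f (sigma3 t))

/-- The operators `𝒫_*^±` of the group `A₂^*`, with `e = 1` for `𝒫_*^+` and `e = -1` for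
`𝒫_*^-`. -/
def projA2Star (e : ℂ) (f : (Fin 3 → ℝ) → ℂ) (t : Fin 3 → ℝ) : ℂ :=
  (1 / 6) * (f t + f (sigma2 (sigma1 t)) + f (sigma1 (sigma2 t))
    + e * f (-sigma1 t) + e * f (-sigma2 t) + e * f (-sigma3 t))

/-- The exponentials `φ_k(t) = exp (2 π i (k · t) / 3)`. -/
def phi (k : Fin 3 → ℤ) (t : Fin 3 → ℝ) : ℂ :=
  Complex.exp (2 * Real.pi * Complex.I / 3 * ((∑ i, (k i : ℝ) * t i : ℝ) : ℂ))

/-- The generalized cosine `CC_k = 𝒫_*^+ 𝒫^+ φ_k`. -/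
def CC (k : Fin 3 → ℤ) (t : Fin 3 → ℝ) : ℂ := projA2Star 1 (projA2 1 (phi k)) t

/-- The generalized sine `SS_k = - 𝒫_*^- 𝒫^- φ_k`. -/
def SS (k : Fin 3 → ℤ) (t : Fin 3 → ℝ) : ℂ := -projA2Star (-1) (projA2 (-1) (phi k)) t

/-- `CC_k` is real valued, so that taking real parts below loses nothing. -/
theorem CC_im (k : Fin 3 → ℤ) (t : Fin 3 → ℝ) : (CC k t).im = 0 := by
  have hphi : ∀ s : Fin 3 → ℝ, phi k (-s) = (starRingEnd ℂ) (phi k s) := by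
    intro s
    simp only [phi, ← Complex.exp_conj, map_mul, map_div₀, Complex.conj_I, Complex.conj_ofReal,
      map_ofNat, Pi.neg_apply, mul_neg, Finset.sum_neg_distrib, Complex.ofReal_neg]
    congr 1
    ring
  have h1 : ∀ s : Fin 3 → ℝ, sigma1 (-s) = -sigma1 s := fun s => by
    ext i; fin_cases i <;> simp [sigma1]
  have h2 : ∀ s : Fin 3 → ℝ, sigma2 (-s) = -sigma2 s := fun s => by
    ext i; fin_cases i <;> simp [sigma2]
  have h3 : ∀ s : Fin 3 → ℝ, sigma3 (-s) = -sigma3 s := fun s => by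
    ext i; fin_cases i <;> simp [sigma3]
  have h11 : ∀ s : Fin 3 → ℝ, sigma1 (sigma1 s) = s := fun s => by
    ext i; fin_cases i <;> simp [sigma1]
  have h22 : ∀ s : Fin 3 → ℝ, sigma2 (sigma2 s) = s := fun s => by
    ext i; fin_cases i <;> simp [sigma2]
  have h33 : ∀ s : Fin 3 → ℝ, sigma3 (sigma3 s) = s := fun s => by
    ext i; fin_cases i <;> simp [sigma3]
  have h121 : ∀ s : Fin 3 → ℝ, sigma1 (sigma2 (sigma1 s)) = sigma3 s := fun s => by
    ext i; fin_cases i <;> simp [sigma1, sigma2, sigma3]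
  have h212 : ∀ s : Fin 3 → ℝ, sigma2 (sigma1 (sigma2 s)) = sigma3 s := fun s => by
    ext i; fin_cases i <;> simp [sigma1, sigma2, sigma3]
  have h13 : ∀ s : Fin 3 → ℝ, sigma1 (sigma3 s) = sigma2 (sigma1 s) := fun s => by
    ext i; fin_cases i <;> simp [sigma1, sigma2, sigma3]
  have h23 : ∀ s : Fin 3 → ℝ, sigma2 (sigma3 s) = sigma1 (sigma2 s) := fun s => by
    ext i; fin_cases i <;> simp [sigma1, sigma2, sigma3]
  have h31 : ∀ s : Fin 3 → ℝ, sigma3 (sigma1 s) = sigma1 (sigma2 s) := fun s => by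
    ext i; fin_cases i <;> simp [sigma1, sigma2, sigma3]
  have h32 : ∀ s : Fin 3 → ℝ, sigma3 (sigma2 s) = sigma2 (sigma1 s) := fun s => by
    ext i; fin_cases i <;> simp [sigma1, sigma2, sigma3]
  rw [← Complex.conj_eq_iff_im]
  simp only [CC, projA2Star, projA2, h1, h2, h3, hphi, h11, h22, h33, h121, h212, h13, h23, h31,
    h32, map_mul, map_add, map_one, map_div₀, map_ofNat, Complex.conj_conj]
  ring

/-! ### The change of variables and the region -/

/-- `x(t) = CC_{1,0,-1}(t)`. -/
def xCoord (t : Fin 3 → ℝ) : ℝ := (CC ![1, 0, -1] t).re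

/-- `y(t) = CC_{1,1,-2}(t)`. -/
def yCoord (t : Fin 3 → ℝ) : ℝ := (CC ![1, 1, -2] t).re

/-- The first factor `1 + 2y - 3x²` of the polynomial defining the boundary of the region. -/
def bdryA (p : ℝ × ℝ) : ℝ := 1 + 2 * p.2 - 3 * p.1 ^ 2

/-- The second factor `24x³ - y² - 12xy - 6x - 4y - 1`. -/
def bdryB (p : ℝ × ℝ) : ℝ :=
  24 * p.1 ^ 3 - p.2 ^ 2 - 12 * p.1 * p.2 - 6 * p.1 - 4 * p.2 - 1

/-- The bounded region `△^*` enclosed by the two curves. Both factors are required to be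
nonnegative: where both are negative their product is positive too, but those points form an
unbounded set outside the curves. -/
def deltaStar : Set (ℝ × ℝ) := {p | 0 ≤ bdryA p ∧ 0 ≤ bdryB p}

/-- The weight `w_{α,β}(x,y) = (4π²)^{α+β} / 3^{2α+β} · (1+2y-3x²)^α · (24x³-…-1)^β`. -/
def weight (α β : ℝ) (p : ℝ × ℝ) : ℝ :=
  (4 * Real.pi ^ 2) ^ (α + β) / 3 ^ (2 * α + β) * bdryA p ^ α * bdryB p ^ β

/-- The normalization constant `c_{α,β} = 1 / ∫_{△^*} w_{α,β}`. -/
def normConst (α β : ℝ) : ℝ := 1 / ∫ p in deltaStar, weight α β p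

/-! ### Nodes and polynomial spaces -/

/-- The interior index set
`Υ_n^° = {j ∈ ℤ³ : j₁+j₂+j₃ = 0, j₁ ≡ j₂ ≡ j₃ (mod 3), 0 < j₂ < j₁ < -j₃ < n}`. -/
def upsilonInt (n : ℕ) : Finset (Fin 3 → ℤ) :=
  (Fintype.piFinset fun _ : Fin 3 => Finset.Icc (-(n : ℤ)) n).filter fun j =>
    j 0 + j 1 + j 2 = 0 ∧ (j 0 ≡ j 1 [ZMOD 3] ∧ j 1 ≡ j 2 [ZMOD 3]) ∧
      0 < j 1 ∧ j 1 < j 0 ∧ j 0 < -j 2 ∧ -j 2 < n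

/-- The finite box in the definition of `upsilonInt` imposes no condition of its own. -/
theorem mem_upsilonInt (n : ℕ) (j : Fin 3 → ℤ) :
    j ∈ upsilonInt n ↔
      j 0 + j 1 + j 2 = 0 ∧ (j 0 ≡ j 1 [ZMOD 3] ∧ j 1 ≡ j 2 [ZMOD 3]) ∧
        0 < j 1 ∧ j 1 < j 0 ∧ j 0 < -j 2 ∧ -j 2 < n := by
  simp only [upsilonInt, Finset.mem_filter, Fintype.mem_piFinset, Finset.mem_Icc,
    Fin.forall_fin_succ, and_iff_right_iff_imp]
  rintro ⟨h, -, h1, h2, h3, h4⟩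
  refine ⟨?_, ?_, ?_, fun i => i.elim0⟩ <;> first | omega | (simp; omega)

/-- The point `j / n` in homogeneous coordinates. -/
def scaled (n : ℕ) (j : Fin 3 → ℤ) : Fin 3 → ℝ := fun i => (j i : ℝ) / n

/-- The point `(x(j/n), y(j/n))` of the plane. -/
def node (n : ℕ) (j : Fin 3 → ℤ) : ℝ × ℝ := (xCoord (scaled n j), yCoord (scaled n j))

/-- The node set `Y_n^°`. -/
def nodeSet (n : ℕ) : Set (ℝ × ℝ) := node n '' (upsilonInt n : Set (Fin 3 → ℤ))

/-- The space `Π_n^*` of polynomials in two variables of `m`-degree at most `n`, the `m`-degree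
of `x^{k₁} y^{k₂}` being `2k₁ + 3k₂`. -/
def piStar (𝕜 : Type*) [Field 𝕜] (n : ℕ) : Submodule 𝕜 (MvPolynomial (Fin 2) 𝕜) :=
  Submodule.span 𝕜 {p | ∃ k₁ k₂ : ℕ, 2 * k₁ + 3 * k₂ ≤ n ∧ p = X 0 ^ k₁ * X 1 ^ k₂}

/-- The value of a polynomial in two variables at a real point. -/
def evalAt {𝕜 : Type*} [RCLike 𝕜] (f : MvPolynomial (Fin 2) 𝕜) (p : ℝ × ℝ) : 𝕜 :=
  MvPolynomial.eval ![(p.1 : 𝕜), (p.2 : 𝕜)] f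

end G2Cubature

end

open G2Cubature MeasureTheory

/-! In the coordinates `(u, v)` of `toHom`, everything is expressed by the cosines of `2πu`, `2πv`,
`2π(u+v)`: `x` and `y` amount to their symmetric functions `e₁`, `e₂`, and `cos_relation` makes `e₃`
a polynomial in these. The two boundary polynomials multiply to a constant times the discriminant
`vander ^ 2`. Both the Jacobian and `SS_{2,1,-3}` are constant multiples of `vander`, so the
weighted integral and the weighted node sum both become a continuous and a discrete mean of `f ·
vander ^ 2` over a triangle that is one twelfth of the torus `ℝ²/ℤ²`.

There `x`, `y` and `vander ^ 2` are trigonometric polynomials of hexagonal degree 2, 3 and 10, so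
the integrand has degree at most `2n - 1 + 10 < 2(n + 5)`. The `N × N` grid integrates degree below
`2N` exactly, because no nonzero frequency that small is divisible by `N` (`exists_grid_sum_eq`),
and invariance folds the grid onto the triangle (`sum_grid_eq_twelve_mul`). The triangle integral is
identified as the limit of these eventually constant Riemann sums (`lattice_sum_eq_integral`).

The change of variables needs the chart to map the open triangle bijectively onto the open region
(`injOn_chart`, `image_chart`); surjectivity is real-rootedness of the cubic whose roots are the
cosines. Injectivity also makes the nodes distinct. -/

noncomputable section

namespace G2Cubature

/-! ### Chart coordinates and cosine formulas -/

/-- The affine chart of the plane `t₁ + t₂ + t₃ = 0` in which the lattice of periods of the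
coordinate functions is `ℤ²`. -/
def toHom (q : ℝ × ℝ) : Fin 3 → ℝ := ![2 * q.1 + q.2, q.2 - q.1, -(q.1 + 2 * q.2)]

/-- The cosine of `2πu` at `(u, v)`. -/
def cosA (q : ℝ × ℝ) : ℝ := Real.cos (2 * Real.pi * q.1)

/-- The cosine of `2πv` at `(u, v)`. -/
def cosB (q : ℝ × ℝ) : ℝ := Real.cos (2 * Real.pi * q.2)

/-- The cosine of `2π(u + v)` at `(u, v)`. -/
def cosC (q : ℝ × ℝ) : ℝ := Real.cos (2 * Real.pi * (q.1 + q.2))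

/-- The point `(x, y)` in terms of the chart coordinates. -/
def chart (q : ℝ × ℝ) : ℝ × ℝ :=
  ((cosA q + cosB q + cosC q) / 3,
    2 / 3 * (cosA q * cosB q + cosA q * cosC q + cosB q * cosC q)
      - (cosA q + cosB q + cosC q) / 3)

/-- The Vandermonde product of the three cosines. -/
def vander (q : ℝ × ℝ) : ℝ := (cosA q - cosB q) * (cosA q - cosC q) * (cosB q - cosC q)

theorem phi_eq (k : Fin 3 → ℤ) (t : Fin 3 → ℝ) :
    phi k t = (Real.cos (2 * Real.pi / 3 * (k 0 * t 0 + k 1 * t 1 + k 2 * t 2)) : ℂ) +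
      (Real.sin (2 * Real.pi / 3 * (k 0 * t 0 + k 1 * t 1 + k 2 * t 2)) : ℂ) * Complex.I := by
  rw [phi, Fin.sum_univ_three, Complex.ofReal_cos, Complex.ofReal_sin, ← Complex.exp_mul_I]
  congr 1
  push_cast
  ring

/-- The arguments here and in the next three lemmas have the shape that `ring_nf` produces, so that
multiple angles reduce to functions of `2πu`. -/
theorem cos_pi_mul_four (u : ℝ) :
    Real.cos (Real.pi * u * 4) = 2 * Real.cos (Real.pi * u * 2) ^ 2 - 1 := by
  rw [← Real.cos_two_mul]; ring_nf

theorem sin_pi_mul_four (u : ℝ) : Real.sin (Real.pi * u * 4) =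
    2 * Real.sin (Real.pi * u * 2) * Real.cos (Real.pi * u * 2) := by
  rw [← Real.sin_two_mul]; ring_nf

theorem cos_pi_mul_six (u : ℝ) : Real.cos (Real.pi * u * 6) =
    4 * Real.cos (Real.pi * u * 2) ^ 3 - 3 * Real.cos (Real.pi * u * 2) := by
  rw [← Real.cos_three_mul]; ring_nf

theorem sin_pi_mul_six (u : ℝ) : Real.sin (Real.pi * u * 6) =
    3 * Real.sin (Real.pi * u * 2) - 4 * Real.sin (Real.pi * u * 2) ^ 3 := by
  rw [← Real.sin_three_mul]; ring_nf

theorem xCoord_toHom (q : ℝ × ℝ) : xCoord (toHom q) = (chart q).1 := by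
  obtain ⟨u, v⟩ := q
  simp only [xCoord, CC, projA2Star, projA2, phi_eq, sigma1, sigma2, sigma3, toHom, chart, cosA,
    cosB, cosC]
  simp [-Complex.ofReal_cos, -Complex.ofReal_sin]
  ring_nf
  simp only [Real.cos_add, Real.cos_sub, Real.cos_neg, Real.sin_neg]
  ring

theorem yCoord_toHom (q : ℝ × ℝ) : yCoord (toHom q) = (chart q).2 := by
  obtain ⟨u, v⟩ := q
  simp only [yCoord, CC, projA2Star, projA2, phi_eq, sigma1, sigma2, sigma3, toHom, chart, cosA,
    cosB, cosC]
  simp [-Complex.ofReal_cos, -Complex.ofReal_sin]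
  ring_nf
  simp only [Real.cos_add, Real.cos_sub, Real.cos_neg, Real.sin_neg, cos_pi_mul_four,
    sin_pi_mul_four]
  ring

theorem SS_toHom (q : ℝ × ℝ) : SS ![2, 1, -3] (toHom q) = ((2 / 3 * vander q : ℝ) : ℂ) := by
  obtain ⟨u, v⟩ := q
  simp only [SS, projA2Star, projA2, phi_eq, sigma1, sigma2, sigma3, toHom, vander, cosA,
    cosB, cosC]
  refine Complex.ext ?_ ?_
  · simp [-Complex.ofReal_cos, -Complex.ofReal_sin]
    ring_nf
    simp only [Real.cos_add, Real.cos_sub, Real.cos_neg, Real.sin_neg, cos_pi_mul_four,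
      sin_pi_mul_four, cos_pi_mul_six, sin_pi_mul_six]
    have h1 := Real.sin_sq_add_cos_sq (Real.pi * u * 2)
    have h2 := Real.sin_sq_add_cos_sq (Real.pi * v * 2)
    generalize Real.sin (Real.pi * u * 2) = s at *
    generalize Real.cos (Real.pi * u * 2) = c at *
    generalize Real.sin (Real.pi * v * 2) = s' at *
    generalize Real.cos (Real.pi * v * 2) = c' at *
    -- Reduction to degree at most one in each sine leaves a polynomial identity.
    have hs : s ^ 2 = 1 - c ^ 2 := by linarith
    have hs' : s' ^ 2 = 1 - c' ^ 2 := by linarith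
    have hs3 : s ^ 3 = s * (1 - c ^ 2) := by rw [← hs]; ring
    have hs3' : s' ^ 3 = s' * (1 - c' ^ 2) := by rw [← hs']; ring
    ring_nf
    simp only [hs, hs', hs3, hs3']
    ring
  · simp [-Complex.ofReal_cos, -Complex.ofReal_sin]
    ring_nf
    simp only [Real.cos_neg, Real.sin_neg, Real.sin_add, Real.sin_sub]
    ring_nf

/-! ### The boundary curves in terms of the cosines -/

/-- The relation between the cosines of three angles with sum zero. -/
theorem cos_relation (q : ℝ × ℝ) : 1 - cosA q ^ 2 - cosB q ^ 2 - cosC q ^ 2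
    + 2 * cosA q * cosB q * cosC q = 0 := by
  have h1 := Real.sin_sq_add_cos_sq (2 * Real.pi * q.1)
  have h2 := Real.sin_sq_add_cos_sq (2 * Real.pi * q.2)
  simp only [cosA, cosB, cosC, mul_add, Real.cos_add]
  linear_combination (-1 + Real.cos (2 * Real.pi * q.2) ^ 2) * h1 + (-Real.sin (2 * Real.pi * q.1) ^ 2) * h2

/-- Since `e₃ = (e₁² - 1 - 2e₂)/2`, the first factor is `2/3` of the value at `1` of the cubic with
roots `cᵢ`. -/
theorem bdryA_of_relation {c₁ c₂ c₃ : ℝ} (h : 1 - c₁ ^ 2 - c₂ ^ 2 - c₃ ^ 2 + 2 * c₁ * c₂ * c₃ = 0)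
    {p : ℝ × ℝ} (h1 : p.1 = (c₁ + c₂ + c₃) / 3)
    (h2 : p.2 = 2 / 3 * (c₁ * c₂ + c₁ * c₃ + c₂ * c₃) - (c₁ + c₂ + c₃) / 3) :
    bdryA p = 2 / 3 * ((1 - c₁) * (1 - c₂) * (1 - c₃)) := by
  rw [bdryA, h1, h2]
  linear_combination (1 / 3) * h

theorem bdry_mul_of_relation {c₁ c₂ c₃ : ℝ}
    (h : 1 - c₁ ^ 2 - c₂ ^ 2 - c₃ ^ 2 + 2 * c₁ * c₂ * c₃ = 0)
    {p : ℝ × ℝ} (h1 : p.1 = (c₁ + c₂ + c₃) / 3)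
    (h2 : p.2 = 2 / 3 * (c₁ * c₂ + c₁ * c₃ + c₂ * c₃) - (c₁ + c₂ + c₃) / 3) :
    bdryA p * bdryB p = 4 / 27 * ((c₁ - c₂) * (c₁ - c₃) * (c₂ - c₃)) ^ 2 := by
  rw [bdryA, bdryB, h1, h2]
  -- The discriminant is quadratic in `e₃`; the multiplier comes from its divided difference between
  -- `e₃` and `(e₁² - 1 - 2e₂)/2`, which differ by half the relation.
  linear_combination (-(4 / 27)) * (-2 * (c₁ + c₂ + c₃) ^ 3
    + 9 * (c₁ + c₂ + c₃) * (c₁ * c₂ + c₁ * c₃ + c₂ * c₃)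
    - 27 * ((c₁ + c₂ + c₃) ^ 2 - 1 - 2 * (c₁ * c₂ + c₁ * c₃ + c₂ * c₃)) / 2
    - 27 / 4 * (1 - c₁ ^ 2 - c₂ ^ 2 - c₃ ^ 2 + 2 * c₁ * c₂ * c₃)) * h

theorem bdryA_chart (q : ℝ × ℝ) :
    bdryA (chart q) = 2 / 3 * ((1 - cosA q) * (1 - cosB q) * (1 - cosC q)) :=
  bdryA_of_relation (cos_relation q) rfl rfl

theorem bdry_mul_chart (q : ℝ × ℝ) :
    bdryA (chart q) * bdryB (chart q) = 4 / 27 * vander q ^ 2 :=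
  bdry_mul_of_relation (cos_relation q) rfl rfl

/-! ### Trigonometric polynomials and exactness of the grid rule -/

/-- The character of the torus `ℝ²/ℤ²` of frequency `(k, l)`. -/
def torusChar (k l : ℤ) (q : ℝ × ℝ) : ℂ :=
  Complex.exp (2 * Real.pi * Complex.I * (k * q.1 + l * q.2))

/-- The frequencies of degree at most `d`. -/
def freqSet (d : ℤ) : Set (ℝ × ℝ → ℂ) :=
  {e | ∃ k l : ℤ, |k + l| ≤ d ∧ |2 * k - l| ≤ d ∧ |2 * l - k| ≤ d ∧ e = torusChar k l}

/-- The trigonometric polynomials of degree at most `d`. -/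
def trigSpan (d : ℤ) : Submodule ℂ (ℝ × ℝ → ℂ) := Submodule.span ℂ (freqSet d)

theorem torusChar_mul (k l k' l' : ℤ) :
    torusChar k l * torusChar k' l' = torusChar (k + k') (l + l') := by
  ext q
  simp only [Pi.mul_apply, torusChar, ← Complex.exp_add]
  congr 1
  push_cast
  ring

/-- The three absolute values bounding a frequency are subadditive, so degrees add. -/
theorem mul_mem_trigSpan {d e : ℤ} {f g : ℝ × ℝ → ℂ} (hf : f ∈ trigSpan d)
    (hg : g ∈ trigSpan e) : f * g ∈ trigSpan (d + e) := by
  have h := Submodule.mul_mem_mul hf hg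
  rw [trigSpan, trigSpan, Submodule.span_mul_span] at h
  refine Submodule.span_mono ?_ h
  rintro _ ⟨_, ⟨k, l, h1, h2, h3, rfl⟩, _, ⟨k', l', h1', h2', h3', rfl⟩, rfl⟩
  refine ⟨k + k', l + l', ?_, ?_, ?_, torusChar_mul _ _ _ _⟩ <;>
    rw [abs_le] at * <;> constructor <;> linarith

theorem trigSpan_mono {d e : ℤ} (h : d ≤ e) : trigSpan d ≤ trigSpan e := by
  refine Submodule.span_mono ?_
  rintro _ ⟨k, l, h1, h2, h3, rfl⟩
  exact ⟨k, l, h1.trans h, h2.trans h, h3.trans h, rfl⟩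

theorem one_mem_trigSpan : (1 : ℝ × ℝ → ℂ) ∈ trigSpan 0 := by
  refine Submodule.subset_span ⟨0, 0, by simp, by simp, by simp, ?_⟩
  ext q
  simp [torusChar]

theorem pow_mem_trigSpan {d : ℤ} {f : ℝ × ℝ → ℂ} (hf : f ∈ trigSpan d) (n : ℕ) :
    f ^ n ∈ trigSpan (n * d) := by
  induction n with
  | zero => simpa using one_mem_trigSpan
  | succ n ih =>
    rw [pow_succ]
    refine trigSpan_mono (le_of_eq ?_) (mul_mem_trigSpan ih hf)
    push_cast
    ring

theorem cos_mem_trigSpan {d k l : ℤ} (h1 : |k + l| ≤ d) (h2 : |2 * k - l| ≤ d)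
    (h3 : |2 * l - k| ≤ d) :
    (fun q : ℝ × ℝ => ((Real.cos (2 * Real.pi * (k * q.1 + l * q.2)) : ℝ) : ℂ)) ∈ trigSpan d := by
  have h : (fun q : ℝ × ℝ => ((Real.cos (2 * Real.pi * (k * q.1 + l * q.2)) : ℝ) : ℂ)) =
      (1 / 2 : ℂ) • (torusChar k l + torusChar (-k) (-l)) := by
    ext q
    simp only [Complex.ofReal_cos, Complex.cos, Pi.smul_apply, Pi.add_apply, torusChar,
      smul_eq_mul]
    push_cast
    ring_nf
  rw [h]
  refine Submodule.smul_mem _ _ (Submodule.add_mem _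
    (Submodule.subset_span ⟨k, l, h1, h2, h3, rfl⟩)
    (Submodule.subset_span ⟨-k, -l, ?_, ?_, ?_, rfl⟩))
  · rw [← abs_neg]; convert h1 using 2; ring
  · rw [← abs_neg]; convert h2 using 2; ring
  · rw [← abs_neg]; convert h3 using 2; ring

theorem chart_fst_mem_trigSpan :
    (fun q : ℝ × ℝ => (((chart q).1 : ℝ) : ℂ)) ∈ trigSpan 2 := by
  have h1 := cos_mem_trigSpan (d := 2) (k := 1) (l := 0) (by simp) (by simp) (by simp)
  have h2 := cos_mem_trigSpan (d := 2) (k := 0) (l := 1) (by simp) (by simp) (by simp)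
  have h3 := cos_mem_trigSpan (d := 2) (k := 1) (l := 1) (by simp) (by simp) (by simp)
  convert! Submodule.smul_mem _ (1 / 3 : ℂ) (Submodule.add_mem _ (Submodule.add_mem _ h1 h2) h3)
    using 1
  ext q
  simp [chart, cosA, cosB, cosC]
  ring

/-- Products of two cosines suggest degree 4. Product-to-sum formulas cancel the term `-(A + B +
C)/3` and leave only the frequencies `(2,1)`, `(1,2)`, `(1,-1)`, of degree 3. -/
theorem chart_snd_mem_trigSpan :
    (fun q : ℝ × ℝ => (((chart q).2 : ℝ) : ℂ)) ∈ trigSpan 3 := by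
  have h1 := cos_mem_trigSpan (d := 3) (k := 2) (l := 1) (by simp) (by simp) (by simp)
  have h2 := cos_mem_trigSpan (d := 3) (k := 1) (l := 2) (by simp) (by simp) (by simp)
  have h3 := cos_mem_trigSpan (d := 3) (k := 1) (l := -1) (by simp) (by norm_num) (by norm_num)
  convert! Submodule.smul_mem _ (1 / 3 : ℂ) (Submodule.add_mem _ (Submodule.add_mem _ h1 h2) h3)
    using 1
  ext ⟨u, v⟩
  have e1 := Real.two_mul_cos_mul_cos (2 * Real.pi * u) (2 * Real.pi * (u + v))
  have e2 := Real.two_mul_cos_mul_cos (2 * Real.pi * v) (2 * Real.pi * (u + v))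
  have e3 := Real.two_mul_cos_mul_cos (2 * Real.pi * u) (2 * Real.pi * v)
  rw [← Real.cos_neg (_ - _), show -(2 * Real.pi * u - 2 * Real.pi * (u + v)) = 2 * Real.pi * v by ring,
    show 2 * Real.pi * u + 2 * Real.pi * (u + v) = 2 * Real.pi * (2 * u + v) by ring] at e1
  rw [← Real.cos_neg (_ - _), show -(2 * Real.pi * v - 2 * Real.pi * (u + v)) = 2 * Real.pi * u by ring,
    show 2 * Real.pi * v + 2 * Real.pi * (u + v) = 2 * Real.pi * (u + 2 * v) by ring] at e2
  rw [show 2 * Real.pi * u - 2 * Real.pi * v = 2 * Real.pi * (u - v) by ring,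
    show 2 * Real.pi * u + 2 * Real.pi * v = 2 * Real.pi * (u + v) by ring] at e3
  have e : (chart (u, v)).2 = 1 / 3 * (Real.cos (2 * Real.pi * (2 * u + v)) +
      Real.cos (2 * Real.pi * (u + 2 * v)) + Real.cos (2 * Real.pi * (u - v))) := by
    simp only [chart, cosA, cosB, cosC]
    linear_combination (1 / 3) * e1 + (1 / 3) * e2 + (1 / 3) * e3
  simp only [e, Pi.smul_apply, Pi.add_apply, smul_eq_mul]
  push_cast
  ring_nf

theorem torusChar_grid_sum {N : ℕ} (hN : 0 < N) (k l : ℤ) :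
    ∑ z ∈ Finset.Ico (0 : ℤ) N ×ˢ Finset.Ico (0 : ℤ) N, torusChar k l (z.1 / N, z.2 / N) =
      if (N : ℤ) ∣ k ∧ (N : ℤ) ∣ l then (N : ℂ) ^ 2 else 0 := by
  have key : ∀ k : ℤ, ∑ p ∈ Finset.Ico (0 : ℤ) N,
      Complex.exp (2 * Real.pi * Complex.I * k / N) ^ p = if (N : ℤ) ∣ k then (N : ℂ) else 0 := by
    intro k
    have hN0 : (N : ℂ) ≠ 0 := by exact_mod_cast hN.ne'
    have e : ∑ p ∈ Finset.Ico (0 : ℤ) N, Complex.exp (2 * Real.pi * Complex.I * k / N) ^ p =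
        ∑ p ∈ Finset.range N, Complex.exp (2 * Real.pi * Complex.I * k / N) ^ p := by
      refine Finset.sum_nbij' Int.toNat (fun n => (n : ℤ)) ?_ ?_ ?_ ?_ ?_
      · intro a ha; simp at ha ⊢; omega
      · intro a ha; simp at ha ⊢; omega
      · intro a ha; simp at ha ⊢; omega
      · intro a ha; simp
      · intro a ha
        rw [← zpow_natCast, Int.toNat_of_nonneg (Finset.mem_Ico.1 ha).1]
    have hone : Complex.exp (2 * Real.pi * Complex.I * k / N) = 1 ↔ (N : ℤ) ∣ k := by
      rw [Complex.exp_eq_one_iff]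
      have hpi : (2 * Real.pi * Complex.I : ℂ) ≠ 0 := Complex.two_pi_I_ne_zero
      constructor
      · rintro ⟨n, hn⟩
        refine ⟨n, ?_⟩
        have : (k : ℂ) = N * n := by
          field_simp at hn
          have := mul_left_cancel₀ hpi (b := (k : ℂ)) (c := N * n) (by linear_combination (2 * Real.pi * Complex.I) * hn)
          exact this
        exact_mod_cast this
      · rintro ⟨n, rfl⟩
        refine ⟨n, ?_⟩
        push_cast
        field_simp
    rw [e]
    split_ifs with h
    · rw [hone.2 h]; simp
    · have h1 : Complex.exp (2 * Real.pi * Complex.I * k / N) ≠ 1 := fun h' => h (hone.1 h')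
      rw [geom_sum_eq h1, ← Complex.exp_nat_mul]
      have : Complex.exp (N * (2 * Real.pi * Complex.I * k / N)) = 1 := by
        rw [Complex.exp_eq_one_iff]
        exact ⟨k, by field_simp⟩
      simp [this]
  have e : ∀ z : ℤ × ℤ, torusChar k l (z.1 / N, z.2 / N) =
      Complex.exp (2 * Real.pi * Complex.I * k / N) ^ z.1 *
        Complex.exp (2 * Real.pi * Complex.I * l / N) ^ z.2 := by
    intro z
    rw [← Complex.exp_int_mul, ← Complex.exp_int_mul, ← Complex.exp_add, torusChar]
    congr 1
    push_cast
    ring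
  simp_rw [e]
  rw [Finset.sum_product, ← Finset.sum_mul_sum, key, key]
  split_ifs <;> simp_all [sq]

/-- The equidistant grid rule is exact on trigonometric polynomials of degree below `2N`. -/
theorem exists_grid_sum_eq {d : ℤ} {F : ℝ × ℝ → ℂ} (hF : F ∈ trigSpan d) :
    ∃ c : ℂ, ∀ N : ℕ, 0 < N → d < 2 * N →
      ∑ z ∈ Finset.Ico (0 : ℤ) N ×ˢ Finset.Ico (0 : ℤ) N, F (z.1 / N, z.2 / N) = (N : ℂ) ^ 2 * c := by
  induction hF using Submodule.span_induction with
  | mem f hf =>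
    obtain ⟨k, l, h1, h2, h3, rfl⟩ := hf
    -- The constant is the zeroth Fourier coefficient. Its independence of `N` later allows `N → ∞`.
    refine ⟨if k = 0 ∧ l = 0 then 1 else 0, fun N hN hd => ?_⟩
    rw [torusChar_grid_sum hN]
    have : ((N : ℤ) ∣ k ∧ (N : ℤ) ∣ l) ↔ (k = 0 ∧ l = 0) := by
      constructor
      · rintro ⟨⟨a, rfl⟩, ⟨b, rfl⟩⟩
        have hN' : (0 : ℤ) < N := by exact_mod_cast hN
        -- A frequency `N(a, b)` of degree below `2N` has all three forms in `(a, b)` bounded by 1;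
        -- since `(a + b) + (2a - b) = 3a`, this forces `a = 0`, then `b = 0`.
        have red : ∀ m : ℤ, |N * m| ≤ d → |m| ≤ 1 := by
          intro m hm
          rw [abs_mul, abs_of_pos hN'] at hm
          by_contra hcon
          nlinarith
        have g1 := red (a + b) (by convert h1 using 2; ring)
        have g2 := red (2 * a - b) (by convert h2 using 2; ring)
        have g3 := red (2 * b - a) (by convert h3 using 2; ring)
        rw [abs_le] at g1 g2 g3
        have ha : a = 0 := by omega
        have hb : b = 0 := by omega
        simp [ha, hb]
      · rintro ⟨rfl, rfl⟩; simp
    simp only [this]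
    split_ifs <;> simp
  | zero => exact ⟨0, by simp⟩
  | add f g _ _ hf hg =>
    obtain ⟨c, hc⟩ := hf
    obtain ⟨c', hc'⟩ := hg
    refine ⟨c + c', fun N hN hd => ?_⟩
    simp only [Pi.add_apply, Finset.sum_add_distrib, hc N hN hd, hc' N hN hd, mul_add]
  | smul a f _ hf =>
    obtain ⟨c, hc⟩ := hf
    refine ⟨a * c, fun N hN hd => ?_⟩
    simp only [Pi.smul_apply, smul_eq_mul, ← Finset.mul_sum, hc N hN hd]
    ring

/-! ### Folding the grid onto the fundamental triangle -/

/-- The lattice points of the open fundamental triangle, scaled by `N`. -/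
def latticeTriangle (N : ℤ) : Finset (ℤ × ℤ) :=
  (Finset.Ico 0 N ×ˢ Finset.Ico 0 N).filter
    fun z => 0 < z.1 ∧ z.1 < z.2 ∧ z.1 + 2 * z.2 < N

/-- The three symmetries generate a group of order 12 on the grid modulo `N`, and `G` vanishes on
all mirrors. Negation folds across `p + q = N` (factor 2), the swap across `p = q` (factor 2), and
the rank of `N - p - q` relative to `p < q` gives the last factor 3. -/
theorem sum_grid_eq_twelve_mul (N : ℤ) (G : ℤ × ℤ → ℝ)
    (hneg : ∀ p q : ℤ, G (N - p, N - q) = G (p, q)) (hswap : ∀ p q, G (q, p) = G (p, q))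
    (hrot : ∀ p q : ℤ, G (p, N - p - q) = G (p, q)) (h0 : ∀ q, G (0, q) = 0)
    (hdiag : ∀ p, G (p, p) = 0) :
    ∑ z ∈ Finset.Ico 0 N ×ˢ Finset.Ico 0 N, G z =
      12 * ∑ z ∈ latticeTriangle N, G z := by
  set S := Finset.Ico 0 N ×ˢ Finset.Ico 0 N with hS
  have h0' : ∀ p, G (p, 0) = 0 := fun p => by rw [hswap, h0]
  have hanti : ∀ p : ℤ, G (p, N - p) = 0 := fun p => by
    have := hrot p 0
    rw [sub_zero] at this
    rw [this, h0']
  have h1 : ∑ z ∈ S, G z = ∑ z ∈ S with 0 < z.1 ∧ 0 < z.2 ∧ z.1 + z.2 < N, G z +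
      ∑ z ∈ S with 0 < z.1 ∧ 0 < z.2 ∧ N < z.1 + z.2, G z := by
    rw [Finset.sum_filter, Finset.sum_filter, ← Finset.sum_add_distrib]
    refine Finset.sum_congr rfl ?_
    rintro ⟨p, q⟩ hz
    simp only [hS, Finset.mem_product, Finset.mem_Ico] at hz
    split_ifs with ha hb hb
    · omega
    · simp
    · simp
    · have : p = 0 ∨ q = 0 ∨ q = N - p := by simp only at ha hb; omega
      rcases this with rfl | rfl | rfl
      · simp [h0]
      · simp [h0']
      · simp [hanti]
  have h2 : ∑ z ∈ S with 0 < z.1 ∧ 0 < z.2 ∧ N < z.1 + z.2, G z =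
      ∑ z ∈ S with 0 < z.1 ∧ 0 < z.2 ∧ z.1 + z.2 < N, G z := by
    refine Finset.sum_nbij' (fun z => (N - z.1, N - z.2)) (fun z => (N - z.1, N - z.2))
      ?_ ?_ ?_ ?_ ?_
    · rintro ⟨p, q⟩ hz
      simp only [hS, Finset.mem_filter, Finset.mem_product, Finset.mem_Ico] at hz ⊢
      omega
    · rintro ⟨p, q⟩ hz
      simp only [hS, Finset.mem_filter, Finset.mem_product, Finset.mem_Ico] at hz ⊢
      omega
    · rintro ⟨p, q⟩ _; simp
    · rintro ⟨p, q⟩ _; simp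
    · rintro ⟨p, q⟩ _; rw [hneg]
  have h3 : ∑ z ∈ S with 0 < z.1 ∧ 0 < z.2 ∧ z.1 + z.2 < N, G z =
      ∑ z ∈ S with 0 < z.1 ∧ z.1 < z.2 ∧ z.1 + z.2 < N, G z +
      ∑ z ∈ S with 0 < z.2 ∧ z.2 < z.1 ∧ z.1 + z.2 < N, G z := by
    rw [Finset.sum_filter, Finset.sum_filter, Finset.sum_filter, ← Finset.sum_add_distrib]
    refine Finset.sum_congr rfl ?_
    rintro ⟨p, q⟩ hz
    by_cases hpq : p = q
    · subst hpq; simp [hdiag]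
    · split_ifs <;> first | (exfalso; simp only at *; omega) | simp
  have h4 : ∑ z ∈ S with 0 < z.2 ∧ z.2 < z.1 ∧ z.1 + z.2 < N, G z =
      ∑ z ∈ S with 0 < z.1 ∧ z.1 < z.2 ∧ z.1 + z.2 < N, G z := by
    refine Finset.sum_nbij' Prod.swap Prod.swap ?_ ?_ ?_ ?_ ?_
    · rintro ⟨p, q⟩ hz
      simp only [hS, Finset.mem_filter, Finset.mem_product, Finset.mem_Ico, Prod.swap] at hz ⊢
      omega
    · rintro ⟨p, q⟩ hz
      simp only [hS, Finset.mem_filter, Finset.mem_product, Finset.mem_Ico, Prod.swap] at hz ⊢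
      omega
    · rintro ⟨p, q⟩ _; simp
    · rintro ⟨p, q⟩ _; simp
    · rintro ⟨p, q⟩ _; rw [Prod.swap, hswap]
  have h5 : ∑ z ∈ S with 0 < z.1 ∧ z.1 < z.2 ∧ z.1 + z.2 < N, G z =
      ∑ z ∈ latticeTriangle N, G z +
      ∑ z ∈ S with 0 < z.1 ∧ z.1 < N - z.1 - z.2 ∧ N - z.1 - z.2 < z.2, G z +
      ∑ z ∈ S with 0 < N - z.1 - z.2 ∧ N - z.1 - z.2 < z.1 ∧ z.1 < z.2, G z := by
    rw [latticeTriangle, Finset.sum_filter, Finset.sum_filter, Finset.sum_filter,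
      Finset.sum_filter, ← Finset.sum_add_distrib, ← Finset.sum_add_distrib]
    refine Finset.sum_congr rfl ?_
    rintro ⟨p, q⟩ hz
    simp only [Finset.mem_product, Finset.mem_Ico] at hz
    by_cases hp : N - p - q = p
    · have : G (p, q) = 0 := by rw [← hrot, hp, hdiag]
      simp [this]
    by_cases hq : N - q - p = q
    · have : G (p, q) = 0 := by rw [← hswap, ← hrot, hq, hdiag]
      simp [this]
    split_ifs <;> first | (exfalso; simp only at *; omega) | simp
  have h6 : ∑ z ∈ S with 0 < z.1 ∧ z.1 < N - z.1 - z.2 ∧ N - z.1 - z.2 < z.2, G z =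
      ∑ z ∈ latticeTriangle N, G z := by
    refine Finset.sum_nbij' (fun z => (z.1, N - z.1 - z.2)) (fun z => (z.1, N - z.1 - z.2))
      ?_ ?_ ?_ ?_ ?_
    · rintro ⟨p, q⟩ hz
      simp only [latticeTriangle, hS, Finset.mem_filter, Finset.mem_product, Finset.mem_Ico] at hz ⊢
      omega
    · rintro ⟨p, q⟩ hz
      simp only [latticeTriangle, hS, Finset.mem_filter, Finset.mem_product, Finset.mem_Ico] at hz ⊢
      omega
    · rintro ⟨p, q⟩ _; simp
    · rintro ⟨p, q⟩ _; simp
    · rintro ⟨p, q⟩ _; rw [hrot]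
  have h7 : ∑ z ∈ S with 0 < N - z.1 - z.2 ∧ N - z.1 - z.2 < z.1 ∧ z.1 < z.2, G z =
      ∑ z ∈ latticeTriangle N, G z := by
    refine Finset.sum_nbij' (fun z => (N - z.1 - z.2, z.1)) (fun z => (z.2, N - z.1 - z.2))
      ?_ ?_ ?_ ?_ ?_
    · rintro ⟨p, q⟩ hz
      simp only [latticeTriangle, hS, Finset.mem_filter, Finset.mem_product, Finset.mem_Ico] at hz ⊢
      omega
    · rintro ⟨p, q⟩ hz
      simp only [latticeTriangle, hS, Finset.mem_filter, Finset.mem_product, Finset.mem_Ico] at hz ⊢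
      omega
    · rintro ⟨p, q⟩ _; simp only [Prod.mk.injEq, true_and]; ring
    · rintro ⟨p, q⟩ _; simp only [Prod.mk.injEq, and_true]; ring
    · rintro ⟨p, q⟩ _; exact ((hswap p (N - p - q)).trans (hrot p q)).symm
  rw [h1, h2, h3, h4, h5, h6, h7]
  ring

/-! ### Riemann sums and the lattice rule on the triangle -/

/-- The open fundamental triangle in the chart coordinates. -/
def triangle : Set (ℝ × ℝ) := {q | 0 < q.1 ∧ q.1 < q.2 ∧ q.1 + 2 * q.2 < 1}

theorem isOpen_triangle : IsOpen triangle := by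
  have h1 : IsOpen {q : ℝ × ℝ | 0 < q.1} := isOpen_lt (by fun_prop) (by fun_prop)
  have h2 : IsOpen {q : ℝ × ℝ | q.1 < q.2} := isOpen_lt (by fun_prop) (by fun_prop)
  have h3 : IsOpen {q : ℝ × ℝ | q.1 + 2 * q.2 < 1} := isOpen_lt (by fun_prop) (by fun_prop)
  exact h1.inter (h2.inter h3)

theorem mem_latticeTriangle {N : ℤ} {z : ℤ × ℤ} :
    z ∈ latticeTriangle N ↔ 0 < z.1 ∧ z.1 < z.2 ∧ z.1 + 2 * z.2 < N := by
  simp only [latticeTriangle, Finset.mem_filter, Finset.mem_product, Finset.mem_Ico,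
    and_iff_right_iff_imp]
  omega

theorem triangle_subset : triangle ⊆ Set.Icc (0 : ℝ × ℝ) 1 := by
  rintro ⟨u, v⟩ ⟨h1, h2, h3⟩
  simp only at h1 h2 h3
  refine ⟨⟨?_, ?_⟩, ⟨?_, ?_⟩⟩ <;> simp <;> linarith

open scoped Pointwise in
/-- Riemann sums over the lattice points of the fundamental triangle. -/
theorem tendsto_lattice_sum {F : ℝ × ℝ → ℝ} (hF : Continuous F) :
    Filter.Tendsto (fun N : ℕ => (∑ z ∈ latticeTriangle N, F (z.1 / N, z.2 / N)) / (N : ℝ) ^ 2)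
      Filter.atTop (nhds (∫ q in triangle, F q)) := by
  set e := MeasurableEquiv.finTwoArrow (α := ℝ)
  have he : ∀ x, e x = (x 0, x 1) := fun x => rfl
  set s : Set (Fin 2 → ℝ) := e ⁻¹' triangle with hs
  have hcont : Continuous e := by
    have : (e : (Fin 2 → ℝ) → ℝ × ℝ) = fun x => (x 0, x 1) := rfl
    rw [this]; fun_prop
  have hmeas : MeasurableSet s := e.measurable isOpen_triangle.measurableSet
  have hbdd : Bornology.IsBounded s := by
    refine (Metric.isBounded_Icc (0 : Fin 2 → ℝ) 1).subset ?_
    intro x hx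
    obtain ⟨⟨h1, h2⟩, ⟨h3, h4⟩⟩ := triangle_subset hx
    constructor <;> intro i <;> fin_cases i <;> assumption
  have hconv : Convex ℝ s := by
    rintro x ⟨h1, h2, h3⟩ y ⟨h4, h5, h6⟩ a b ha hb hab
    simp only [he] at h1 h2 h3 h4 h5 h6
    have hpos : 0 < a ∨ 0 < b := by
      by_contra! h
      linarith
    refine ⟨?_, ?_, ?_⟩ <;>
      simp only [he, Pi.add_apply, Pi.smul_apply, smul_eq_mul] <;>
      rcases hpos with h | h <;> nlinarith
  -- Convexity makes the frontier null, as convergence of the Riemann sums requires.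
  have key := tendsto_tsum_div_pow_atTop_integral (ι := Fin 2) s (F ∘ e) (hF.comp hcont) hbdd hmeas
    (hconv.addHaar_frontier _)
  have hint : ∫ x in s, (F ∘ e) x = ∫ q in triangle, F q :=
    (volume_preserving_finTwoArrow ℝ).setIntegral_preimage_emb e.measurableEmbedding F triangle
  rw [hint] at key
  refine key.congr' ?_
  filter_upwards [Filter.eventually_gt_atTop 0] with N hN
  have hN' : (0 : ℝ) < N := by exact_mod_cast hN
  have hinj : Function.Injective (fun z : ℤ × ℤ => ![(z.1 : ℝ) / N, (z.2 : ℝ) / N]) := by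
    intro z w h
    have h0 := congrFun h 0
    have h1 := congrFun h 1
    simp only [Matrix.cons_val_zero, Matrix.cons_val_one, div_left_inj' hN'.ne', Int.cast_inj]
      at h0 h1
    exact Prod.ext h0 h1
  have hset : s ∩ ((N : ℝ)⁻¹ • (Submodule.span ℤ (Set.range (Pi.basisFun ℝ (Fin 2))) : Set (Fin 2 → ℝ))) =
      ((latticeTriangle N).map ⟨_, hinj⟩ : Finset (Fin 2 → ℝ)) := by
    have : NeZero N := ⟨hN.ne'⟩
    ext x
    have hm : (x ∈ (N : ℝ)⁻¹ • (Submodule.span ℤ (Set.range (Pi.basisFun ℝ (Fin 2))) : Set (Fin 2 → ℝ))) ↔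
        ∀ i, N * x i ∈ Set.range (algebraMap ℤ ℝ) :=
      BoxIntegral.unitPartition.mem_smul_span_iff
    rw [Set.mem_inter_iff, hm]
    simp only [hs, Set.mem_preimage, he, triangle, Set.mem_ofPred_eq, Finset.coe_map, Set.mem_image,
      Finset.mem_coe, mem_latticeTriangle, Function.Embedding.coeFn_mk]
    constructor
    · rintro ⟨⟨h1, h2, h3⟩, h⟩
      obtain ⟨p, hp⟩ := h 0
      obtain ⟨q, hq⟩ := h 1
      simp only [algebraMap_int_eq, eq_intCast] at hp hq
      refine ⟨(p, q), ⟨?_, ?_, ?_⟩, ?_⟩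
      · have : (0 : ℝ) < p := by rw [hp]; positivity
        exact_mod_cast this
      · have : (p : ℝ) < q := by rw [hp, hq]; gcongr
        exact_mod_cast this
      · have : (p : ℝ) + 2 * q < N := by rw [hp, hq]; nlinarith
        exact_mod_cast this
      · ext i
        fin_cases i
        · simp [hp, hN'.ne']
        · simp [hq, hN'.ne']
    · rintro ⟨⟨p, q⟩, ⟨h1, h2, h3⟩, rfl⟩
      have h1' : (0 : ℝ) < p := by exact_mod_cast h1
      have h2' : (p : ℝ) < q := by exact_mod_cast h2
      have h3' : (p : ℝ) + 2 * q < N := by exact_mod_cast h3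
      refine ⟨⟨?_, ?_, ?_⟩, ?_⟩
      · simp; positivity
      · simp; gcongr
      · simp only [Matrix.cons_val_zero, Matrix.cons_val_one]
        rw [← mul_div_assoc, ← add_div, div_lt_one hN']
        exact h3'
      · intro i
        fin_cases i
        · exact ⟨p, by simp; field_simp⟩
        · exact ⟨q, by simp; field_simp⟩
  rw [hset, Finset.tsum_subtype', Finset.sum_map]
  simp [he]

/-- Each of the three symmetries permutes the cosines; `chart` is symmetric in them and `vander`
alternating. -/
theorem chart_swap (u v : ℝ) : chart (v, u) = chart (u, v) ∧ vander (v, u) ^ 2 = vander (u, v) ^ 2 := by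
  have h : cosC (v, u) = cosC (u, v) := by simp [cosC, add_comm]
  have h1 : cosA (v, u) = cosB (u, v) := rfl
  have h2 : cosB (v, u) = cosA (u, v) := rfl
  constructor
  · ext <;> simp only [chart, h, h1, h2] <;> ring
  · simp only [vander, h, h1, h2]; ring

theorem chart_rot (u v : ℝ) : chart (u, 1 - u - v) = chart (u, v) ∧
    vander (u, 1 - u - v) ^ 2 = vander (u, v) ^ 2 := by
  have h1 : cosA (u, 1 - u - v) = cosA (u, v) := rfl
  have h2 : cosB (u, 1 - u - v) = cosC (u, v) := by
    simp only [cosB, cosC]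
    rw [← Real.cos_two_pi_sub]; ring_nf
  have h3 : cosC (u, 1 - u - v) = cosB (u, v) := by
    simp only [cosB, cosC]
    rw [← Real.cos_two_pi_sub]; ring_nf
  constructor
  · ext <;> simp only [chart, h1, h2, h3] <;> ring
  · simp only [vander, h1, h2, h3]; ring

theorem chart_neg (u v : ℝ) : chart (1 - u, 1 - v) = chart (u, v) ∧
    vander (1 - u, 1 - v) ^ 2 = vander (u, v) ^ 2 := by
  have h1 : cosA (1 - u, 1 - v) = cosA (u, v) := by
    simp only [cosA]
    rw [← Real.cos_two_pi_sub]; ring_nf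
  have h2 : cosB (1 - u, 1 - v) = cosB (u, v) := by
    simp only [cosB]
    rw [← Real.cos_two_pi_sub]; ring_nf
  have h3 : cosC (1 - u, 1 - v) = cosC (u, v) := by
    simp only [cosC]
    rw [← Real.cos_two_pi_sub, ← Real.cos_add_two_pi]; ring_nf
  simp only [chart, vander, h1, h2, h3, and_self]

theorem vander_zero_left (v : ℝ) : vander (0, v) = 0 := by
  simp [vander, cosB, cosC]

theorem vander_diag (u : ℝ) : vander (u, u) = 0 := by
  simp [vander, cosA, cosB]

theorem continuous_chart : Continuous chart := by
  unfold chart cosA cosB cosC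
  fun_prop

theorem continuous_vander : Continuous vander := by
  unfold vander cosA cosB cosC
  fun_prop

/-- The lattice rule in the fundamental triangle. -/
theorem lattice_sum_eq_integral {h : ℝ × ℝ → ℝ} (hc : Continuous h) {d : ℤ}
    (hmem : (fun q => ((h (chart q) * vander q ^ 2 : ℝ) : ℂ)) ∈ trigSpan d) {N : ℕ} (hN : 0 < N)
    (hd : d < 2 * N) :
    ∑ z ∈ latticeTriangle N, h (chart (z.1 / N, z.2 / N)) * vander (z.1 / N, z.2 / N) ^ 2 =
      (N : ℝ) ^ 2 * ∫ q in triangle, h (chart q) * vander q ^ 2 := by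
  obtain ⟨c, hgrid⟩ := exists_grid_sum_eq hmem
  have key : ∀ N : ℕ, 0 < N → d < 2 * N →
      ∑ z ∈ latticeTriangle N, h (chart (z.1 / N, z.2 / N)) * vander (z.1 / N, z.2 / N) ^ 2 =
        (N : ℝ) ^ 2 * (c.re / 12) := by
    intro N hN hd
    have h1 := congrArg Complex.re (hgrid N hN hd)
    rw [← Complex.ofReal_sum, Complex.ofReal_re, ← Complex.ofReal_natCast, ← Complex.ofReal_pow,
      Complex.re_ofReal_mul] at h1
    have hN0 : (N : ℝ) ≠ 0 := by exact_mod_cast hN.ne'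
    have h2 := sum_grid_eq_twelve_mul (N : ℤ)
      (fun z => h (chart (z.1 / N, z.2 / N)) * vander (z.1 / N, z.2 / N) ^ 2)
      (fun p q => by
        have := chart_neg (p / N) (q / N)
        simp only [Int.cast_sub, Int.cast_natCast, sub_div, div_self hN0, this])
      (fun p q => by simp only [chart_swap (p / N) (q / N)])
      (fun p q => by
        have := chart_rot (p / N) (q / N)
        simp only [Int.cast_sub, Int.cast_natCast, sub_div, div_self hN0, this])
      (fun q => by simp [vander_zero_left])
      (fun p => by simp [vander_diag])
    linarith
  -- The normalized sums equal `c.re / 12` for all large `N` and converge to the integral, which is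
  -- therefore `c.re / 12`.
  have hlim := tendsto_lattice_sum (F := fun q => h (chart q) * vander q ^ 2)
    ((hc.comp continuous_chart).mul (continuous_vander.pow 2))
  have hconst : Filter.Tendsto (fun N : ℕ => (∑ z ∈ latticeTriangle N,
      h (chart (z.1 / N, z.2 / N)) * vander (z.1 / N, z.2 / N) ^ 2) / (N : ℝ) ^ 2)
      Filter.atTop (nhds (c.re / 12)) := by
    refine tendsto_const_nhds.congr' ?_
    filter_upwards [Filter.eventually_gt_atTop (max 0 d.toNat)] with M hM
    have h1 : 0 < M := by omega
    rw [key M h1 (by omega), mul_div_cancel_left₀]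
    exact pow_ne_zero _ (by exact_mod_cast h1.ne')
  rw [key N hN hd, tendsto_nhds_unique hlim hconst]

/-- Bounding `vander ^ 2` as a product of six differences would give degree 12, too large for `N = n
+ 5`. The boundary factors have degrees 4 and 6, and their product gives the 10 that is needed. -/
theorem monomial_mem_trigSpan (k₁ k₂ : ℕ) :
    (fun q => (((chart q).1 ^ k₁ * (chart q).2 ^ k₂ * vander q ^ 2 : ℝ) : ℂ)) ∈
      trigSpan (2 * k₁ + 3 * k₂ + 10) := by
  set x : ℝ × ℝ → ℂ := fun q => (((chart q).1 : ℝ) : ℂ) with hx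
  set y : ℝ × ℝ → ℂ := fun q => (((chart q).2 : ℝ) : ℂ) with hy
  have hX (k : ℕ) : x ^ k ∈ trigSpan (k * 2) := pow_mem_trigSpan chart_fst_mem_trigSpan k
  have hY (k : ℕ) : y ^ k ∈ trigSpan (k * 3) := pow_mem_trigSpan chart_snd_mem_trigSpan k
  have h1 (d : ℤ) (hd : 0 ≤ d) : (1 : ℝ × ℝ → ℂ) ∈ trigSpan d :=
    trigSpan_mono hd one_mem_trigSpan
  have hA : 1 + (2 : ℂ) • y ^ 1 - (3 : ℂ) • x ^ 2 ∈ trigSpan 4 :=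
    Submodule.sub_mem _ (Submodule.add_mem _ (h1 _ (by norm_num))
      (Submodule.smul_mem _ _ (trigSpan_mono (by norm_num) (hY 1))))
      (Submodule.smul_mem _ _ (trigSpan_mono (by norm_num) (hX 2)))
  have hB : (24 : ℂ) • x ^ 3 - y ^ 2 - (12 : ℂ) • (x ^ 1 * y ^ 1) - (6 : ℂ) • x ^ 1
      - (4 : ℂ) • y ^ 1 - 1 ∈ trigSpan 6 :=
    Submodule.sub_mem _ (Submodule.sub_mem _ (Submodule.sub_mem _ (Submodule.sub_mem _
      (Submodule.sub_mem _
        (Submodule.smul_mem _ _ (trigSpan_mono (by norm_num) (hX 3)))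
        (trigSpan_mono (by norm_num) (hY 2)))
      (Submodule.smul_mem _ _ (trigSpan_mono (by norm_num) (mul_mem_trigSpan (hX 1) (hY 1)))))
      (Submodule.smul_mem _ _ (trigSpan_mono (by norm_num) (hX 1))))
      (Submodule.smul_mem _ _ (trigSpan_mono (by norm_num) (hY 1))))
      (h1 _ (by norm_num))
  have h := Submodule.smul_mem _ (27 / 4 : ℂ) (mul_mem_trigSpan
    (mul_mem_trigSpan (hX k₁) (hY k₂)) (mul_mem_trigSpan hA hB))
  refine (congrArg (· ∈ trigSpan (2 * k₁ + 3 * k₂ + 10)) ?_).mpr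
    (trigSpan_mono (le_of_eq (by ring)) h)
  ext q
  have e : vander q ^ 2 = 27 / 4 * (bdryA (chart q) * bdryB (chart q)) := by
    rw [bdry_mul_chart]; ring
  rw [e, bdryA, bdryB]
  simp only [hx, hy, Pi.smul_apply, Pi.mul_apply, Pi.pow_apply, Pi.add_apply, Pi.sub_apply,
    Pi.one_apply, smul_eq_mul]
  push_cast
  ring

/-! ### The chart as a bijection onto the open region -/

theorem cos_order_of_mem_triangle {q : ℝ × ℝ} (hq : q ∈ triangle) :
    cosC q < cosB q ∧ cosB q < cosA q ∧ cosA q < 1 := by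
  obtain ⟨h1, h2, h3⟩ := hq
  have hpi := Real.pi_pos
  refine ⟨?_, ?_, ?_⟩
  · rcases le_total (q.1 + q.2) (1 / 2) with h | h
    · exact Real.cos_lt_cos_of_nonneg_of_le_pi (by nlinarith) (by nlinarith) (by nlinarith)
    · rw [cosC, ← Real.cos_two_pi_sub]
      exact Real.cos_lt_cos_of_nonneg_of_le_pi (by nlinarith) (by nlinarith) (by nlinarith)
  · exact Real.cos_lt_cos_of_nonneg_of_le_pi (by nlinarith) (by nlinarith) (by nlinarith)
  · rw [← Real.cos_zero]
    exact Real.cos_lt_cos_of_nonneg_of_le_pi le_rfl (by nlinarith) (by nlinarith)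

theorem eq_of_sorted_of_symm_eq {a b c a' b' c' : ℝ} (h1 : c < b) (h2 : b < a) (h1' : c' < b')
    (h2' : b' < a') (e1 : a + b + c = a' + b' + c')
    (e2 : a * b + a * c + b * c = a' * b' + a' * c' + b' * c')
    (e3 : a * b * c = a' * b' * c') : a = a' ∧ b = b' ∧ c = c' := by
  have root : ∀ t, (t - a) * (t - b) * (t - c) = 0 → t = a' ∨ t = b' ∨ t = c' := by
    intro t ht
    have : (t - a') * ((t - b') * (t - c')) = 0 := by
      linear_combination ht + t ^ 2 * e1 - t * e2 + e3
    simpa [sub_eq_zero] using this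
  have ha := root a (by ring)
  have hb := root b (by ring)
  have hc := root c (by ring)
  rcases ha with ha | ha | ha <;> rcases hb with hb | hb | hb <;> rcases hc with hc | hc | hc <;>
    refine ⟨?_, ?_, ?_⟩ <;> linarith

/-- The image fixes `e₁`, `e₂` and, by the relation, `e₃`, hence the cosines in order; `2πu` and
`2πv` lie in `[0, π]`, where cosine is injective. -/
theorem injOn_chart : Set.InjOn chart triangle := by
  intro q hq q' hq' h
  obtain ⟨h1, h2, -⟩ := cos_order_of_mem_triangle hq
  obtain ⟨h1', h2', -⟩ := cos_order_of_mem_triangle hq'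
  have hx : (chart q).1 = (chart q').1 := by rw [h]
  have hy : (chart q).2 = (chart q').2 := by rw [h]
  simp only [chart] at hx hy
  have e1 : cosA q + cosB q + cosC q = cosA q' + cosB q' + cosC q' := by linarith
  have e2 : cosA q * cosB q + cosA q * cosC q + cosB q * cosC q =
      cosA q' * cosB q' + cosA q' * cosC q' + cosB q' * cosC q' := by linarith
  obtain ⟨ha, hb, -⟩ := eq_of_sorted_of_symm_eq h1 h2 h1' h2' e1 e2 (by
    have r := cos_relation q
    have r' := cos_relation q'
    linear_combination (1 / 2) * r - (1 / 2) * r' - e2 +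
      (1 / 2) * (cosA q + cosB q + cosC q + cosA q' + cosB q' + cosC q') * e1)
  have hpi := Real.pi_pos
  obtain ⟨g1, g2, g3⟩ := hq
  obtain ⟨g1', g2', g3'⟩ := hq'
  have ha' := Real.injOn_cos ⟨by nlinarith, by nlinarith⟩ ⟨by nlinarith, by nlinarith⟩ ha
  have hb' := Real.injOn_cos ⟨by nlinarith, by nlinarith⟩ ⟨by nlinarith, by nlinarith⟩ hb
  exact Prod.ext (mul_left_cancel₀ (by positivity) ha') (mul_left_cancel₀ (by positivity) hb')

/-- The open region bounded by the two curves. -/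
def openRegion : Set (ℝ × ℝ) := {p | 0 < bdryA p ∧ 0 < bdryB p}

theorem vander_pos {q : ℝ × ℝ} (hq : q ∈ triangle) : 0 < vander q := by
  obtain ⟨h1, h2, -⟩ := cos_order_of_mem_triangle hq
  have := sub_pos.2 h1
  have := sub_pos.2 h2
  have := sub_pos.2 (h1.trans h2)
  exact mul_pos (mul_pos ‹_› ‹_›) ‹_›

theorem chart_mem_openRegion {q : ℝ × ℝ} (hq : q ∈ triangle) : chart q ∈ openRegion := by
  obtain ⟨h1, h2, h3⟩ := cos_order_of_mem_triangle hq
  have hA : 0 < bdryA (chart q) := by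
    rw [bdryA_chart]
    have := sub_pos.2 h3
    have := sub_pos.2 (h2.trans h3)
    have := sub_pos.2 (h1.trans (h2.trans h3))
    positivity
  refine ⟨hA, ?_⟩
  have h : 0 < bdryA (chart q) * bdryB (chart q) := by
    rw [bdry_mul_chart]
    have := vander_pos hq
    positivity
  exact (mul_pos_iff_of_pos_left hA).1 h

/-- Dividing the cubic by `T - r` leaves a quadratic; the discriminant of the cubic is that of the
quadratic times the square of its value at `r`. -/
theorem disc_eq_of_root {e₁ e₂ r : ℝ}
    (hr : r ^ 3 - e₁ * r ^ 2 + e₂ * r - (e₁ ^ 2 - 1 - 2 * e₂) / 2 = 0) :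
    ((r - e₁) ^ 2 - 4 * (e₂ + r * (r - e₁))) *
        (r ^ 2 + (r - e₁) * r + (e₂ + r * (r - e₁))) ^ 2 =
      27 / 4 * (bdryA (e₁ / 3, 2 / 3 * e₂ - e₁ / 3) * bdryB (e₁ / 3, 2 / 3 * e₂ - e₁ / 3)) := by
  simp only [bdryA, bdryB]
  linear_combination (-4 * e₁ ^ 3 + 18 * e₁ * e₂ - 27 * (e₁ ^ 2 - 1 - 2 * e₂) -
    27 * (r ^ 3 - e₁ * r ^ 2 + e₂ * r - (e₁ ^ 2 - 1 - 2 * e₂) / 2)) * hr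

/-- For `|r| < 1` the relation reads `(1 - r²)(1 - t²) = (s - rt)²`, and likewise with `s`, `t`
exchanged. For `r = -1` it forces `t = -s`, and `hst` becomes `0 < 1 - s²`. -/
theorem sq_le_one_of_relation {r s t : ℝ} (h1 : -1 ≤ r) (h2 : r < 1)
    (hrel : 1 - r ^ 2 - s ^ 2 - t ^ 2 + 2 * r * s * t = 0) (hst : 0 < (1 - s) * (1 - t)) :
    s ^ 2 ≤ 1 ∧ t ^ 2 ≤ 1 := by
  rcases h1.eq_or_lt with h | h
  · have h0 : s + t = 0 := by
      have : (s + t) ^ 2 = 0 := by rw [← h] at hrel; linarith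
      simpa using this
    have : t = -s := by linarith
    subst this
    constructor <;> nlinarith
  · have h3 : 0 < 1 - r ^ 2 := by nlinarith
    have h4 : (1 - r ^ 2) * (1 - t ^ 2) = (s - r * t) ^ 2 := by linear_combination hrel
    have h5 : (1 - r ^ 2) * (1 - s ^ 2) = (t - r * s) ^ 2 := by linear_combination hrel
    constructor
    · have := (mul_nonneg_iff_of_pos_left h3).1 (h5 ▸ sq_nonneg (t - r * s))
      linarith
    · have := (mul_nonneg_iff_of_pos_left h3).1 (h4 ▸ sq_nonneg (s - r * t))
      linarith

/-- On the open region the cubic whose roots are the three cosines splits: one root in `[-1, 1]`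
comes from the intermediate value theorem, the other two from the sign of the discriminant. -/
theorem exists_cosines {e₁ e₂ : ℝ} (hA : 0 < bdryA (e₁ / 3, 2 / 3 * e₂ - e₁ / 3))
    (hB : 0 < bdryB (e₁ / 3, 2 / 3 * e₂ - e₁ / 3)) :
    ∃ r s t : ℝ, -1 ≤ r ∧ r ≤ 1 ∧ t < s ∧ r ≠ s ∧ r ≠ t ∧ r + s + t = e₁ ∧
      r * s + r * t + s * t = e₂ ∧ 1 - r ^ 2 - s ^ 2 - t ^ 2 + 2 * r * s * t = 0 := by
  obtain ⟨r, ⟨hr1, hr2⟩, hr⟩ : ∃ r ∈ Set.Icc (-1 : ℝ) 1,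
      r ^ 3 - e₁ * r ^ 2 + e₂ * r - (e₁ ^ 2 - 1 - 2 * e₂) / 2 = 0 := by
    have hc : ContinuousOn (fun t : ℝ => t ^ 3 - e₁ * t ^ 2 + e₂ * t - (e₁ ^ 2 - 1 - 2 * e₂) / 2)
        (Set.Icc (-1) 1) := by
      fun_prop
    -- The cubic equals `-(1 + e₁)²/2` at `-1` and `3/2 · bdryA` at `1`.
    refine intermediate_value_Icc (by norm_num) hc ⟨?_, ?_⟩
    · nlinarith [sq_nonneg (1 + e₁)]
    · simp only [bdryA] at hA
      linarith
  have hpos := disc_eq_of_root hr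
  -- The cofactor of `T - r` is `T² + αT + β`; positivity of the discriminant gives it two real
  -- roots, both different from `r`.
  obtain ⟨α, hα⟩ : ∃ α, α = r - e₁ := ⟨_, rfl⟩
  obtain ⟨β, hβ⟩ : ∃ β, β = e₂ + r * α := ⟨_, rfl⟩
  rw [← hα, ← hβ] at hpos
  replace hpos : 0 < (α ^ 2 - 4 * β) * (r ^ 2 + α * r + β) ^ 2 := by rw [hpos]; positivity
  have hne : r ^ 2 + α * r + β ≠ 0 := by
    intro h
    rw [h] at hpos
    simp at hpos
  have hd : 0 < α ^ 2 - 4 * β := pos_of_mul_pos_left hpos (sq_nonneg _)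
  obtain ⟨δ, hδ⟩ : ∃ δ, δ = Real.sqrt (α ^ 2 - 4 * β) := ⟨_, rfl⟩
  have hδ2 : δ ^ 2 = α ^ 2 - 4 * β := by rw [hδ, Real.sq_sqrt hd.le]
  have hδ0 : 0 < δ := by rw [hδ]; exact Real.sqrt_pos.2 hd
  refine ⟨r, (-α + δ) / 2, (-α - δ) / 2, hr1, hr2, by linarith, ?_, ?_, ?_, ?_, ?_⟩
  · intro h
    apply hne
    linear_combination (r + (α + δ) / 2) * h + (1 / 4) * hδ2
  · intro h
    apply hne
    linear_combination (r + (α - δ) / 2) * h + (1 / 4) * hδ2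
  · rw [hα]; ring
  · linear_combination (-1 / 4) * hδ2 + hβ
  · have : 1 - r ^ 2 - ((-α + δ) / 2) ^ 2 - ((-α - δ) / 2) ^ 2 +
        2 * r * ((-α + δ) / 2) * ((-α - δ) / 2) = 1 - r ^ 2 - α ^ 2 + 2 * β + 2 * r * β := by
      linear_combination (-(1 / 2) - r / 2) * hδ2
    rw [this, hβ, hα]
    linear_combination 2 * hr

/-- A point of the open region comes from three distinct cosines satisfying the relation. -/
theorem exists_sorted_cosines {p : ℝ × ℝ} (hp : p ∈ openRegion) :
    ∃ a b c : ℝ, c < b ∧ b < a ∧ a ≤ 1 ∧ -1 ≤ c ∧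
      1 - a ^ 2 - b ^ 2 - c ^ 2 + 2 * a * b * c = 0 ∧ p.1 = (a + b + c) / 3 ∧
      p.2 = 2 / 3 * (a * b + a * c + b * c) - (a + b + c) / 3 := by
  obtain ⟨x, y⟩ := p
  have hxy : ((3 * x) / 3, 2 / 3 * (3 * (x + y) / 2) - (3 * x) / 3) = (x, y) := by
    ext <;> simp only <;> ring
  obtain ⟨r, s, t, hr1, hr2, hst, hrs, hrt, e1, e2, hrel⟩ :=
    exists_cosines (e₁ := 3 * x) (e₂ := 3 * (x + y) / 2) (by rw [hxy]; exact hp.1)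
      (by rw [hxy]; exact hp.2)
  have hx : x = (r + s + t) / 3 := by linarith
  have hy : y = 2 / 3 * (r * s + r * t + s * t) - (r + s + t) / 3 := by linarith
  have hA : 0 < (1 - r) * ((1 - s) * (1 - t)) := by
    have h1 := bdryA_of_relation hrel (p := (x, y)) hx hy
    have h2 := hp.1
    linarith
  have hr : r < 1 := lt_of_le_of_ne hr2 (by rintro rfl; simp at hA)
  obtain ⟨hs, ht⟩ := sq_le_one_of_relation hr1 hr hrel
    ((mul_pos_iff_of_pos_left (by linarith)).1 hA)
  obtain ⟨hs1, hs2⟩ := abs_le.1 ((sq_le_one_iff_abs_le_one s).1 hs)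
  obtain ⟨ht1, ht2⟩ := abs_le.1 ((sq_le_one_iff_abs_le_one t).1 ht)
  rcases lt_or_gt_of_ne hrs with h | h
  · rcases lt_or_gt_of_ne hrt with h' | h'
    · exact ⟨s, t, r, h', hst, hs2, hr1, by linarith, by simp only; linarith,
        by simp only; linarith⟩
    · exact ⟨s, r, t, h', h, hs2, ht1, by linarith, by simp only; linarith,
        by simp only; linarith⟩
  · exact ⟨r, s, t, hst, h, hr2, ht1, hrel, hx, hy⟩

theorem image_chart : chart '' triangle = openRegion := by
  refine Set.Subset.antisymm (Set.image_subset_iff.2 fun q hq => chart_mem_openRegion hq) ?_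
  intro p hp
  obtain ⟨c₁, c₂, c₃, h1, h2, h3, h4, hrel, hx, hy⟩ := exists_sorted_cosines hp
  have hpi := Real.pi_pos
  have hca : Real.cos (Real.arccos c₁) = c₁ := Real.cos_arccos (by linarith) h3
  have hcb : Real.cos (Real.arccos c₂) = c₂ := Real.cos_arccos (by linarith) (by linarith)
  have ha0 := Real.arccos_nonneg c₁
  have hb0 := Real.arccos_nonneg c₂
  have hapi := Real.arccos_le_pi c₁
  have hbpi := Real.arccos_le_pi c₂
  have hab : Real.arccos c₁ < Real.arccos c₂ :=
    Real.arccos_lt_arccos (by linarith) h2 h3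
  set a := Real.arccos c₁ with ha
  set b := Real.arccos c₂ with hb
  -- The relation is quadratic in `c₃` with roots `cos (a + b)` and `cos (b - a)`. The latter is at
  -- least `cos b = c₂`, contrary to `c₃ < c₂`.
  have hc3 : c₃ = Real.cos (a + b) := by
    have hsq : (c₃ - Real.cos (a + b)) * (c₃ - Real.cos (b - a)) = 0 := by
      rw [Real.cos_add, Real.cos_sub, hca, hcb]
      have s1 := Real.sin_sq_add_cos_sq a
      have s2 := Real.sin_sq_add_cos_sq b
      rw [hca] at s1
      rw [hcb] at s2
      linear_combination (-1) * hrel + (-1 + c₂ ^ 2) * s1 - Real.sin a ^ 2 * s2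
    rcases mul_eq_zero.1 hsq with h | h
    · linarith
    · have := Real.cos_le_cos_of_nonneg_of_le_pi (x := b - a) (y := b) (by linarith) hbpi
        (by linarith)
      linarith
  have hlt : a + 2 * b < 2 * Real.pi := by
    by_contra! h
    have := Real.cos_le_cos_of_nonneg_of_le_pi (x := 2 * Real.pi - (a + b)) (y := b) (by linarith)
      hbpi (by linarith)
    rw [Real.cos_two_pi_sub] at this
    linarith
  have hapos : 0 < a := by
    refine lt_of_le_of_ne ha0 fun h => ?_
    rw [← h, zero_add] at hc3
    linarith
  refine ⟨(a / (2 * Real.pi), b / (2 * Real.pi)), ⟨by positivity, ?_, ?_⟩, ?_⟩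
  · simp only; gcongr
  · simp only
    rw [← mul_div_assoc, ← add_div, div_lt_one (by positivity)]
    exact hlt
  · have e1 : cosA (a / (2 * Real.pi), b / (2 * Real.pi)) = c₁ := by
      rw [← hca, cosA]; congr 1; field_simp
    have e2 : cosB (a / (2 * Real.pi), b / (2 * Real.pi)) = c₂ := by
      rw [← hcb, cosB]; congr 1; field_simp
    have e3 : cosC (a / (2 * Real.pi), b / (2 * Real.pi)) = c₃ := by
      rw [hc3, cosC]; congr 1; field_simp
    rw [chart, e1, e2, e3]
    exact Prod.ext hx.symm hy.symm

/-! ### Jacobian, change of variables and normalization -/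

/-- The derivative of the chart. -/
def fderivChart (q : ℝ × ℝ) : ℝ × ℝ →L[ℝ] ℝ × ℝ :=
  let a := Real.sin (2 * Real.pi * q.1)
  let b := Real.sin (2 * Real.pi * q.2)
  let c := Real.sin (2 * Real.pi * (q.1 + q.2))
  (Matrix.toLin (.finTwoProd ℝ) (.finTwoProd ℝ)
    !![-(2 * Real.pi / 3) * (a + c), -(2 * Real.pi / 3) * (b + c);
      -(4 * Real.pi / 3) * (a * (cosB q + cosC q) + c * (cosA q + cosB q))
        + (2 * Real.pi / 3) * (a + c),
      -(4 * Real.pi / 3) * (b * (cosA q + cosC q) + c * (cosA q + cosB q))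
        + (2 * Real.pi / 3) * (b + c)]).toContinuousLinearMap

theorem hasFDerivAt_chart (q : ℝ × ℝ) : HasFDerivAt chart (fderivChart q) q := by
  unfold fderivChart
  rw [Matrix.toLin_finTwoProd_toContinuousLinearMap]
  have hA : HasFDerivAt cosA _ q :=
    ((hasFDerivAt_fst (𝕜 := ℝ) (p := q)).const_mul (2 * Real.pi)).cos
  have hB : HasFDerivAt cosB _ q :=
    ((hasFDerivAt_snd (𝕜 := ℝ) (p := q)).const_mul (2 * Real.pi)).cos
  have hC : HasFDerivAt cosC _ q :=
    (((hasFDerivAt_fst (𝕜 := ℝ) (p := q)).add hasFDerivAt_snd).const_mul (2 * Real.pi)).cos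
  have hx := ((hA.add hB).add hC).const_mul (1 / 3)
  have hy := ((((hA.mul hB).add (hA.mul hC)).add (hB.mul hC)).const_mul (2 / 3)).sub hx
  have h := hx.prodMk hy
  convert! h using 1
  · ext p <;> simp [chart] <;> ring
  · ext <;> simp <;> ring

theorem det_fderivChart (q : ℝ × ℝ) :
    (fderivChart q).det = 8 * Real.pi ^ 2 / 9 * vander q := by
  unfold fderivChart
  simp only [LinearMap.det_toContinuousLinearMap, LinearMap.det_toLin, Matrix.det_fin_two_of]
  have h1 := Real.sin_sq_add_cos_sq (2 * Real.pi * q.1)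
  have h2 := Real.sin_sq_add_cos_sq (2 * Real.pi * q.2)
  simp only [vander, cosA, cosB, cosC, mul_add, Real.cos_add, Real.sin_add]
  generalize Real.sin (2 * Real.pi * q.1) = a at *
  generalize Real.cos (2 * Real.pi * q.1) = b at *
  generalize Real.sin (2 * Real.pi * q.2) = c at *
  generalize Real.cos (2 * Real.pi * q.2) = d at *
  linear_combination 8 * Real.pi ^ 2 / 9 *
    ((b - (b * d - a * c)) * d * h1 + ((b * d - a * c) - d) * b * h2)

/-- The constant relating the pulled back weight to `vander ^ 2`. -/
def jacConst : ℝ :=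
  8 * Real.pi ^ 2 / 9 * ((4 * Real.pi ^ 2) ^ ((1 / 2 : ℝ) + 1 / 2) / 3 ^ (2 * (1 / 2 : ℝ) + 1 / 2)) *
    Real.sqrt (4 / 27)

theorem jacConst_pos : 0 < jacConst := by
  have := Real.pi_pos
  unfold jacConst
  positivity

/-- With both exponents `1/2` the weight contributes one factor `vander` and the Jacobian another,
which makes the pulled-back density smooth. -/
theorem abs_det_mul_weight {q : ℝ × ℝ} (hq : q ∈ triangle) :
    |(fderivChart q).det| * weight (1 / 2) (1 / 2) (chart q) = jacConst * vander q ^ 2 := by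
  have hV := vander_pos hq
  obtain ⟨hA, hB⟩ := chart_mem_openRegion hq
  have h : bdryA (chart q) ^ (1 / 2 : ℝ) * bdryB (chart q) ^ (1 / 2 : ℝ) =
      Real.sqrt (4 / 27) * vander q := by
    rw [← Real.mul_rpow hA.le hB.le, bdry_mul_chart, ← Real.sqrt_eq_rpow,
      Real.sqrt_mul (by norm_num), Real.sqrt_sq hV.le]
  rw [det_fderivChart, abs_of_pos (by positivity), weight, jacConst]
  linear_combination 8 * Real.pi ^ 2 / 9 * vander q *
    ((4 * Real.pi ^ 2) ^ ((1 / 2 : ℝ) + 1 / 2) / 3 ^ (2 * (1 / 2 : ℝ) + 1 / 2)) * h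

/-- Positive exponents make the weight vanish on the boundary, so passing to the open region needs
no null-set argument. -/
theorem weight_eq_zero {p : ℝ × ℝ} (hp : p ∈ deltaStar \ openRegion) :
    weight (1 / 2) (1 / 2) p = 0 := by
  obtain ⟨⟨hA, hB⟩, h⟩ := hp
  have : bdryA p = 0 ∨ bdryB p = 0 := by
    by_contra! hne
    exact h ⟨lt_of_le_of_ne hA hne.1.symm, lt_of_le_of_ne hB hne.2.symm⟩
  rcases this with h | h <;> simp [weight, h]

theorem openRegion_subset : openRegion ⊆ deltaStar := fun _ hp => ⟨hp.1.le, hp.2.le⟩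

theorem measurableSet_deltaStar : MeasurableSet deltaStar := by
  have h1 : IsClosed {p : ℝ × ℝ | 0 ≤ bdryA p} :=
    isClosed_le (by fun_prop) (by unfold bdryA; fun_prop)
  have h2 : IsClosed {p : ℝ × ℝ | 0 ≤ bdryB p} :=
    isClosed_le (by fun_prop) (by unfold bdryB; fun_prop)
  exact (h1.inter h2).measurableSet

theorem abs_det_smul {h : ℝ × ℝ → ℝ} {q : ℝ × ℝ} (hq : q ∈ triangle) :
    |(fderivChart q).det| • (h (chart q) * weight (1 / 2) (1 / 2) (chart q)) =
      jacConst * (h (chart q) * vander q ^ 2) := by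
  rw [smul_eq_mul]
  linear_combination h (chart q) * abs_det_mul_weight hq

theorem integrableOn_mul_weight {h : ℝ × ℝ → ℝ} (hh : Continuous h) :
    IntegrableOn (fun p => h p * weight (1 / 2) (1 / 2) p) deltaStar := by
  have h1 : IntegrableOn (fun p => h p * weight (1 / 2) (1 / 2) p) openRegion := by
    rw [← image_chart, integrableOn_image_iff_integrableOn_abs_det_fderiv_smul volume
      isOpen_triangle.measurableSet (fun q _ => (hasFDerivAt_chart q).hasFDerivWithinAt)
      injOn_chart]
    have hc : Continuous (fun q => jacConst * (h (chart q) * vander q ^ 2)) :=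
      ((hh.comp continuous_chart).mul (continuous_vander.pow 2)).const_mul _
    refine ((hc.continuousOn.integrableOn_compact isCompact_Icc).mono_set
      triangle_subset).congr_fun (fun q hq => ?_) isOpen_triangle.measurableSet
    exact (abs_det_smul hq).symm
  exact h1.of_forall_sdiff_eq_zero measurableSet_deltaStar fun p hp => by
    rw [weight_eq_zero hp, mul_zero]

theorem integral_mul_weight (h : ℝ × ℝ → ℝ) :
    ∫ p in deltaStar, h p * weight (1 / 2) (1 / 2) p =
      jacConst * ∫ q in triangle, h (chart q) * vander q ^ 2 := by
  rw [setIntegral_eq_of_subset_of_forall_sdiff_eq_zero measurableSet_deltaStar openRegion_subset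
    (fun p hp => by rw [weight_eq_zero hp, mul_zero]), ← image_chart,
    integral_image_eq_integral_abs_det_fderiv_smul volume isOpen_triangle.measurableSet
      (fun q _ => (hasFDerivAt_chart q).hasFDerivWithinAt) injOn_chart, ← integral_const_mul]
  exact setIntegral_congr_fun isOpen_triangle.measurableSet fun q hq => abs_det_smul hq

/-- The lattice rule evaluates it: degree 10 is below `2 · 6`, and for `N = 6` the triangle has a
single lattice point. -/
theorem integral_vander_sq : ∫ q in triangle, vander q ^ 2 = 1 / 64 := by
  have h := lattice_sum_eq_integral (h := fun _ => 1) (N := 6) continuous_const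
    (by simpa using monomial_mem_trigSpan 0 0) (by norm_num) (by norm_num)
  have hs : latticeTriangle ((6 : ℕ) : ℤ) = {(1, 2)} := by decide
  have ha : Real.cos (2 * Real.pi * (1 / 6)) = 1 / 2 := by
    rw [← Real.cos_pi_div_three]; ring_nf
  have hb : Real.cos (2 * Real.pi * (2 / 6)) = -(1 / 2) := by
    rw [← Real.cos_pi_div_three, ← Real.cos_pi_sub]; ring_nf
  have hc : Real.cos (2 * Real.pi * (1 / 6 + 2 / 6)) = -1 := by
    rw [← Real.cos_pi]; ring_nf
  rw [hs, Finset.sum_singleton] at h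
  simp only [one_mul, vander, cosA, cosB, cosC, Int.cast_one, Int.cast_ofNat, Nat.cast_ofNat, ha,
    hb, hc] at h
  simp only [vander, cosA, cosB, cosC]
  linarith

theorem normConst_eq : normConst (1 / 2) (1 / 2) = 64 / jacConst := by
  have h := integral_mul_weight fun _ => 1
  simp only [one_mul, integral_vander_sq] at h
  rw [normConst, h]
  field_simp

/-! ### Nodes and their number -/

/-- The index in `Υ_N^°` of a lattice point of the fundamental triangle. -/
def toIndex (z : ℤ × ℤ) : Fin 3 → ℤ := ![2 * z.1 + z.2, z.2 - z.1, -(z.1 + 2 * z.2)]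

theorem toIndex_injective : Function.Injective toIndex := by
  intro z w h
  have h0 := congrFun h 0
  have h1 := congrFun h 1
  simp only [toIndex, Matrix.cons_val_zero, Matrix.cons_val_one] at h0 h1
  ext <;> omega

theorem upsilonInt_eq_map (N : ℕ) :
    upsilonInt N = (latticeTriangle N).map ⟨toIndex, toIndex_injective⟩ := by
  ext j
  simp only [mem_upsilonInt, Finset.mem_map, mem_latticeTriangle, Function.Embedding.coeFn_mk,
    Int.ModEq]
  constructor
  · rintro ⟨h0, ⟨h1, h2⟩, h3, h4, h5, h6⟩
    -- This inverts `toIndex`; the congruences modulo 3 make both divisions exact.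
    refine ⟨((j 0 - j 1) / 3, (j 0 + 2 * j 1) / 3), ⟨?_, ?_, ?_⟩, ?_⟩
    · simp only; omega
    · simp only; omega
    · simp only; omega
    · ext i
      fin_cases i <;> simp [toIndex] <;> omega
  · rintro ⟨⟨p, q⟩, ⟨h1, h2, h3⟩, rfl⟩
    simp only [toIndex, Matrix.cons_val_zero, Matrix.cons_val_one, Matrix.cons_val]
    omega

theorem scaled_toIndex (N : ℕ) (z : ℤ × ℤ) :
    scaled N (toIndex z) = toHom (z.1 / N, z.2 / N) := by
  ext i
  fin_cases i <;> simp [scaled, toIndex, toHom] <;> ring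

theorem node_toIndex (N : ℕ) (z : ℤ × ℤ) :
    node N (toIndex z) = chart (z.1 / N, z.2 / N) := by
  rw [node, scaled_toIndex, xCoord_toHom, yCoord_toHom]

theorem norm_SS_toIndex (N : ℕ) (z : ℤ × ℤ) :
    ‖SS ![2, 1, -3] (scaled N (toIndex z))‖ ^ 2 = 4 / 9 * vander (z.1 / N, z.2 / N) ^ 2 := by
  rw [scaled_toIndex, SS_toHom, Complex.norm_real, Real.norm_eq_abs, sq_abs]
  ring

theorem div_mem_triangle {N : ℕ} {z : ℤ × ℤ} (hz : z ∈ latticeTriangle N) :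
    ((z.1 / N, z.2 / N) : ℝ × ℝ) ∈ triangle := by
  obtain ⟨h1, h2, h3⟩ := mem_latticeTriangle.1 hz
  have hN : (0 : ℝ) < N := by
    have : (0 : ℤ) < N := by omega
    exact_mod_cast this
  have h1' : (0 : ℝ) < z.1 := by exact_mod_cast h1
  have h2' : (z.1 : ℝ) < z.2 := by exact_mod_cast h2
  have h3' : (z.1 : ℝ) + 2 * z.2 < N := by exact_mod_cast h3
  refine ⟨by positivity, by simp only; gcongr, ?_⟩
  simp only
  rw [← mul_div_assoc, ← add_div, div_lt_one hN]
  exact h3'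

theorem injOn_node (N : ℕ) : Set.InjOn (node N) (upsilonInt N : Set (Fin 3 → ℤ)) := by
  rw [upsilonInt_eq_map]
  intro j hj j' hj' h
  simp only [Finset.coe_map, Set.mem_image, Finset.mem_coe, Function.Embedding.coeFn_mk] at hj hj'
  obtain ⟨z, hz, rfl⟩ := hj
  obtain ⟨w, hw, rfl⟩ := hj'
  rw [node_toIndex, node_toIndex] at h
  have hN : (N : ℝ) ≠ 0 := by
    have := mem_latticeTriangle.1 hz
    have h0 : N ≠ 0 := by omega
    exact_mod_cast h0
  have := injOn_chart (div_mem_triangle hz) (div_mem_triangle hw) h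
  simp only [Prod.mk.injEq, div_left_inj' hN, Int.cast_inj] at this
  rw [Prod.ext this.1 this.2]

theorem ncard_nodeSet (N : ℕ) : (nodeSet N).ncard = (upsilonInt N).card := by
  rw [nodeSet, (injOn_node N).ncard_image, Set.ncard_coe_finset]

/-- The exponents of the monomials of `m`-degree at most `n`. -/
def expSet (n : ℕ) : Finset (ℕ × ℕ) :=
  (Finset.range (n + 1) ×ˢ Finset.range (n + 1)).filter fun k => 2 * k.1 + 3 * k.2 ≤ n

theorem mem_expSet {n : ℕ} {k : ℕ × ℕ} : k ∈ expSet n ↔ 2 * k.1 + 3 * k.2 ≤ n := by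
  simp only [expSet, Finset.mem_filter, Finset.mem_product, Finset.mem_range,
    and_iff_right_iff_imp]
  omega

theorem finrank_piStar (𝕜 : Type*) [Field 𝕜] (n : ℕ) :
    Module.finrank 𝕜 (piStar 𝕜 n) = (expSet n).card := by
  set b : expSet n → MvPolynomial (Fin 2) 𝕜 := fun k => X 0 ^ k.1.1 * X 1 ^ k.1.2 with hb
  have hspan : piStar 𝕜 n = Submodule.span 𝕜 (Set.range b) := by
    rw [piStar]
    congr 1
    ext p
    constructor
    · rintro ⟨k₁, k₂, h, rfl⟩
      exact ⟨⟨(k₁, k₂), mem_expSet.2 h⟩, rfl⟩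
    · rintro ⟨k, rfl⟩
      exact ⟨_, _, mem_expSet.1 k.2, rfl⟩
  have hmon : b = (basisMonomials (Fin 2) 𝕜) ∘
      fun k : expSet n => Finsupp.single 0 k.1.1 + Finsupp.single 1 k.1.2 := by
    ext1 k
    simp [hb, X_pow_eq_monomial, monomial_mul]
  have hli : LinearIndependent 𝕜 b := by
    rw [hmon]
    refine (basisMonomials (Fin 2) 𝕜).linearIndependent.comp _ ?_
    intro k l h
    have h0 := DFunLike.congr_fun h 0
    have h1 := DFunLike.congr_fun h 1
    simp at h0 h1
    exact Subtype.ext (Prod.ext h0 h1)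
  rw [hspan, finrank_span_eq_card hli, Fintype.card_coe]

/-- With `p = k₂ + 1` and `q = k₁ + k₂ + 2` one has `p + 2q = 2k₁ + 3k₂ + 5`, which explains the
shift by 5. -/
theorem card_upsilonInt {n : ℕ} (hn : 1 ≤ n) :
    (upsilonInt (n + 5)).card = (expSet (n - 1)).card := by
  rw [upsilonInt_eq_map, Finset.card_map]
  refine Finset.card_nbij' (fun z => ((z.2 - z.1 - 1).toNat, (z.1 - 1).toNat))
    (fun k => (k.2 + 1, k.2 + k.1 + 2)) ?_ ?_ ?_ ?_
  · rintro ⟨p, q⟩ h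
    simp only [Finset.mem_coe, mem_latticeTriangle, mem_expSet] at h ⊢
    omega
  · rintro ⟨k, l⟩ h
    simp only [Finset.mem_coe, mem_latticeTriangle, mem_expSet] at h ⊢
    omega
  · rintro ⟨p, q⟩ h
    simp only [Finset.mem_coe, mem_latticeTriangle] at h
    simp only [Prod.mk.injEq]
    omega
  · rintro ⟨k, l⟩ h
    simp only [Prod.mk.injEq]
    omega

/-! ### The cubature rule -/

/-- The cubature rule for a single monomial. -/
theorem cubature_monomial {n : ℕ} (hn : 1 ≤ n) {k₁ k₂ : ℕ} (hk : 2 * k₁ + 3 * k₂ ≤ 2 * n - 1) :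
    normConst (1 / 2) (1 / 2) / 12 *
        ∫ p in deltaStar, p.1 ^ k₁ * p.2 ^ k₂ * weight (1 / 2) (1 / 2) p =
      12 / ((n : ℝ) + 5) ^ 2 * ∑ j ∈ upsilonInt (n + 5),
        ‖SS ![2, 1, -3] (scaled (n + 5) j)‖ ^ 2 *
          ((node (n + 5) j).1 ^ k₁ * (node (n + 5) j).2 ^ k₂) := by
  have hJ := jacConst_pos
  -- Exactness holds since `2k₁ + 3k₂ + 10 ≤ 2n + 9 < 2(n + 5)`.
  have hsum := lattice_sum_eq_integral (h := fun p => p.1 ^ k₁ * p.2 ^ k₂) (N := n + 5)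
    (by fun_prop) (monomial_mem_trigSpan k₁ k₂) (by omega) (by push_cast; omega)
  have hint := integral_mul_weight fun p => p.1 ^ k₁ * p.2 ^ k₂
  have hterm : ∑ j ∈ upsilonInt (n + 5), ‖SS ![2, 1, -3] (scaled (n + 5) j)‖ ^ 2 *
      ((node (n + 5) j).1 ^ k₁ * (node (n + 5) j).2 ^ k₂) = 4 / 9 * (((n + 5 : ℕ) : ℝ) ^ 2 *
        ∫ q in triangle, (chart q).1 ^ k₁ * (chart q).2 ^ k₂ * vander q ^ 2) := by
    rw [← hsum, upsilonInt_eq_map, Finset.sum_map, Finset.mul_sum]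
    refine Finset.sum_congr rfl fun z _ => ?_
    simp only [Function.Embedding.coeFn_mk, norm_SS_toIndex, node_toIndex]
    ring
  -- Both sides are `16/3` times the triangle integral: `64/12 = 12 · 4/9`.
  rw [hterm, hint, normConst_eq]
  push_cast
  field_simp
  ring

theorem evalAt_monomial {𝕜 : Type*} [RCLike 𝕜] (k₁ k₂ : ℕ) (p : ℝ × ℝ) :
    evalAt (X 0 ^ k₁ * X 1 ^ k₂ : MvPolynomial (Fin 2) 𝕜) p =
      ((p.1 ^ k₁ * p.2 ^ k₂ : ℝ) : 𝕜) := by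
  simp [evalAt]

/-- Both sides are linear in `f`, which reduces to monomials; integrability is carried through the
induction because additivity of the integral needs it. -/
theorem cubature {𝕜 : Type*} [RCLike 𝕜] {n : ℕ} (hn : 1 ≤ n) {f : MvPolynomial (Fin 2) 𝕜}
    (hf : f ∈ piStar 𝕜 (2 * n - 1)) :
    IntegrableOn (fun p : ℝ × ℝ => evalAt f p * ((weight (1 / 2) (1 / 2) p : ℝ) : 𝕜)) deltaStar ∧
    ((normConst (1 / 2) (1 / 2) / 12 : ℝ) : 𝕜) *
        ∫ p in deltaStar, evalAt f p * ((weight (1 / 2) (1 / 2) p : ℝ) : 𝕜) =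
      ((12 / ((n : ℝ) + 5) ^ 2 : ℝ) : 𝕜) *
        ∑ j ∈ upsilonInt (n + 5),
          ((‖SS ![2, 1, -3] (scaled (n + 5) j)‖ ^ 2 : ℝ) : 𝕜) * evalAt f (node (n + 5) j) := by
  rw [piStar] at hf
  induction hf using Submodule.span_induction with
  | mem f hf =>
    obtain ⟨k₁, k₂, hk, rfl⟩ := hf
    simp only [evalAt_monomial, ← RCLike.ofReal_mul]
    refine ⟨(integrableOn_mul_weight (h := fun p => p.1 ^ k₁ * p.2 ^ k₂) (by fun_prop)).ofReal, ?_⟩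
    rw [integral_ofReal, ← RCLike.ofReal_sum, ← RCLike.ofReal_mul, ← RCLike.ofReal_mul,
      cubature_monomial hn hk]
  | zero => simp [evalAt]
  | add f g _ _ hf hg =>
    have e : ∀ p, evalAt (f + g) p = evalAt f p + evalAt g p := fun p => by simp [evalAt]
    simp only [e, add_mul, mul_add, Finset.sum_add_distrib]
    refine ⟨hf.1.add hg.1, ?_⟩
    rw [integral_add hf.1 hg.1, mul_add, hf.2, hg.2]
  | smul a f _ hf =>
    have e : ∀ p, evalAt (a • f) p = a * evalAt f p := fun p => by simp [evalAt]
    simp only [e, mul_assoc, mul_left_comm _ a, ← Finset.mul_sum]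
    refine ⟨hf.1.const_mul a, ?_⟩
    rw [integral_const_mul, mul_left_comm, hf.2]

end G2Cubature

end

open G2Cubature MeasureTheory
theorem theorem6p1 {𝕜 : Type*} [RCLike 𝕜] (n : ℕ) (hn : 1 ≤ n) :
    (∀ f ∈ piStar 𝕜 (2 * n - 1),
      IntegrableOn (fun p : ℝ × ℝ => evalAt f p * ((weight (1 / 2) (1 / 2) p : ℝ) : 𝕜)) deltaStar ∧
      ((normConst (1 / 2) (1 / 2) / 12 : ℝ) : 𝕜) *
          ∫ p in deltaStar, evalAt f p * ((weight (1 / 2) (1 / 2) p : ℝ) : 𝕜) =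
        ((12 / ((n : ℝ) + 5) ^ 2 : ℝ) : 𝕜) *
          ∑ j ∈ upsilonInt (n + 5),
            ((‖SS ![2, 1, -3] (scaled (n + 5) j)‖ ^ 2 : ℝ) : 𝕜) * evalAt f (node (n + 5) j)) ∧
    (upsilonInt (n + 5)).card = Module.finrank 𝕜 (piStar 𝕜 (n - 1)) ∧
    (nodeSet (n + 5)).ncard = Module.finrank 𝕜 (piStar 𝕜 (n - 1)) := by
  have hcard : (upsilonInt (n + 5)).card = Module.finrank 𝕜 (piStar 𝕜 (n - 1)) := by
    rw [finrank_piStar, card_upsilonInt hn]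
  exact ⟨fun f hf => cubature hn hf, hcard, (ncard_nodeSet _).trans hcard⟩
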